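/- Consider dynamic networks $w=Gw+Rr+He$ with $L$ nodes $w_j$, $K$ external signals $r_k$ and a white noise $e$ of dimension $p\le L$ and covariance $\Lambda$. A network model is a quadruple $(G,R,H,\Lambda)$ where: $G\in\mathbb R^{L\times L}(z)$ has zero diagonal and proper stable entries; $R\in\mathbb R^{L\times K}(z)$ is proper; $H\in\mathbb R^{L\times p}(z)$ is proper and stable with a proper stable left inverse, and its upper $p\times p$ block equals $I_p$ at $z=\infty$; $\Lambda>0$; the network is well-posed, with $(I-G)^{-1}$ proper and stable. (Stable: all poles in $|z|<1$.) Put $U=[R\ \ H]$ and $T=(I-G)^{-1}U$. A network model set $\mathcal M$ is given by declaring each entry of $[G\ \ R\ \ H]$ either known (fixed, possibly $0$; the diagonal of $G$ is known) or parametrized. It consists of all network models with the given known entries, with parametrized entries that are otherwise arbitrary and independent, except that a prescribed set of the parametrized modules is required to be strictly proper, and $\Lambda$ may be restricted to be diagonal. (This covers the case in which all modules are strictly proper, and the case without algebraic loops and with diagonal $\Lambda$.) A property holds for almost all models of $\mathcal M$ if, for every choice of orders $\nu_e\ge1$ of the parametrized entries, it holds for all models of $\mathcal M$ with these orders except for a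 Lebesgue null set of the vectors of numerator coefficients, denominator coefficients (monic denominator of degree $\nu_e$), and entries of $\Lambda$. $\mathcal M$ (respectively its row $j$, its module $G_{ji}$) is generically identifiable if, for almost all $M_0\in\mathcal M$, every $M_1\in\mathcal M$ with the same $T$ as $M_0$ has the same $(G,R,H)$ (respectively the same row $j$ of $G,R,H$; the same $G_{ji}$). Let $\mathcal Y_j$ be the set of nodes $w_k$ such that $G_{jk}$ is parametrized, $\alpha_j=|\mathcal Y_j|$, and let $\mathcal U_j$ be the set of excitations (the $r_k$ and $e_l$) that are not an input to a parametrized entry of row $j$ of $U$. Let $\check T_j$ be the submatrix of $T$ with rows $\mathcal Y_j$ and columns $\mathcal U_j$, and $\check T_{j,(-i,\star)}$ the same matrix without the row of $w_i$. A path goes from an excitation through a nonempty sequence of nodes, each step being an entry of $[G\ \ R\ \ H]$ that is parametrized or known and nonzero; paths are disjoint if they have no node and no excitation in common. Assume that $\mathcal M$ is nonempty and that the known entries do not cancel: every square submatrix of $[I-G\ \ R\ \ H]$ that contains no parametrized entry and has a transversal of nonzero entries is nonsingular over $\mathbb R(z)$. (This is automatic, for example, if all known entries of $G$ are zero and each column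 of $U$ has at most one known nonzero entry.) Then: 1. The following are equivalent: (a) $\mathcal M$ is generically identifiable; (b) each row of $[G\ \ U]$ has at most $K+p$ parametrized entries, and for almost all models in $\mathcal M$ every $\check T_j$ has full row rank; (c) for each $j$ there is a set of $\alpha_j$ disjoint paths from excitations in $\mathcal U_j$ to nodes in $\mathcal Y_j$. 2. For each $j$ the following are equivalent: (a) row $j$ of $\mathcal M$ is generically identifiable; (b) row $j$ of $[G\ \ U]$ has at most $K+p$ parametrized entries, and $\check T_j$ has full row rank for almost all models in $\mathcal M$; (c) there is a set of $\alpha_j$ disjoint paths from excitations in $\mathcal U_j$ to nodes in $\mathcal Y_j$. 3. For each parametrized module $G_{ji}$ the following are equivalent: (a) $G_{ji}$ is generically identifiable; (b) $\operatorname{rank}\check T_j>\operatorname{rank}\check T_{j,(-i,\star)}$ for almost all models in $\mathcal M$; (c) there are a set $\mathcal P$ of disjoint paths from excitations in $\mathcal U_j$ to nodes in $\mathcal Y_j\setminus\{w_i\}$ that has the maximum possible number of paths, and one further path from an excitation in $\mathcal U_j$ to $w_i$ that is disjoint to all paths in $\mathcal P$. -/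

import Mathlib

open scoped Polynomial

noncomputable section

namespace DynNet

/-! ## Real rational transfer functions -/

/-- A rational function `f ∈ ℝ(z)` is proper: finite at `z = ∞`. -/
def IsProper (f : RatFunc ℝ) : Prop := f.num.degree ≤ f.denom.degree

/-- Strictly proper: zero at `z = ∞`. -/
def IsStrictlyProper (f : RatFunc ℝ) : Prop := f.num.degree < f.denom.degree

/-- Stable (discrete time): every pole lies in the open unit disc. -/
def IsStable (f : RatFunc ℝ) : Prop :=
  ∀ z : ℂ, Polynomial.aeval z f.denom = 0 → ‖z‖ < 1

/-- The value `f(∞)` of a proper `f` (the reduced denominator `f.denom` is monic). -/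
def valueAtInfinity (f : RatFunc ℝ) : ℝ := f.num.coeff f.denom.natDegree

/-! ## Network models -/

/-- The external signals that drive the network: the `K` external variables `r_k` (left summand)
and the `p` white noises `e_l` (right summand). -/
abbrev Excitation (K p : ℕ) : Type := Fin K ⊕ Fin p

/-- The signals that index the columns of `[G R H]`: nodes `w_l` (left) and excitations (right). -/
abbrev Signal (L K p : ℕ) : Type := Fin L ⊕ Excitation K p

/-- The data `(G, R, H, Λ)` of a network `w = G w + R r + H e`, `cov e = Λ`. -/
structure NetworkModel (L K p : ℕ) where
  G : Matrix (Fin L) (Fin L) (RatFunc ℝ)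
  R : Matrix (Fin L) (Fin K) (RatFunc ℝ)
  H : Matrix (Fin L) (Fin p) (RatFunc ℝ)
  Λ : Matrix (Fin p) (Fin p) ℝ

namespace NetworkModel

variable {L K p : ℕ}

/-- `U = [R H]`. -/
def U (M : NetworkModel L K p) : Matrix (Fin L) (Excitation K p) (RatFunc ℝ) :=
  Matrix.fromCols M.R M.H

/-- The network transfer matrix `T = [T_wr T_we] = (I - G)⁻¹ [R H]`. -/
def T (M : NetworkModel L K p) : Matrix (Fin L) (Excitation K p) (RatFunc ℝ) :=
  (1 - M.G)⁻¹ * M.U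

/-- Entries of `[G R H]`. -/
def entry (M : NetworkModel L K p) : Matrix (Fin L) (Signal L K p) (RatFunc ℝ) :=
  Matrix.fromCols M.G M.U

/-- The properties required of a network model. -/
structure IsValid (M : NetworkModel L K p) : Prop where
  G_diag : ∀ j, M.G j j = 0
  G_proper : ∀ j l, IsProper (M.G j l)
  G_stable : ∀ j l, IsStable (M.G j l)
  R_proper : ∀ j k, IsProper (M.R j k)
  H_proper : ∀ j m, IsProper (M.H j m)
  H_stable : ∀ j m, IsStable (M.H j m)
  H_leftInverse : ∃ X : Matrix (Fin p) (Fin L) (RatFunc ℝ),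
    (∀ m j, IsProper (X m j) ∧ IsStable (X m j)) ∧ X * M.H = 1
  /-- `[I_p 0] H` is monic, that is, equal to the identity matrix at `z = ∞`. -/
  H_monic : ∀ (j : Fin L) (m : Fin p), (j : ℕ) < p →
    valueAtInfinity (M.H j m) = if (j : ℕ) = (m : ℕ) then 1 else 0
  Λ_posDef : M.Λ.PosDef
  det_ne_zero : (1 - M.G).det ≠ 0
  inv_proper : ∀ j l, IsProper ((1 - M.G)⁻¹ j l)
  inv_stable : ∀ j l, IsStable ((1 - M.G)⁻¹ j l)
  /-- Well-posedness: `I - G(∞)` is invertible and all principal minors of its inverse are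
  nonzero. -/
  wellPosed_inv : (1 - M.G.map valueAtInfinity).det ≠ 0
  wellPosed : ∀ s : Finset (Fin L),
    ((1 - M.G.map valueAtInfinity)⁻¹.submatrix (fun a : s => (a : Fin L))
      (fun a : s => (a : Fin L))).det ≠ 0

end NetworkModel

/-! ## Model sets -/

/-- A network model set, given by which entries of `[G R H]` are parametrized and by the known
values of the other entries. Parametrized entries are independent of each other and range over all
transfer functions compatible with `NetworkModel.IsValid`, except that a parametrized module
`G_{jl}` with `l ∉ feed j` is restricted to be strictly proper. If `diagNoise` holds, the noise
covariance is restricted to diagonal matrices. -/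
structure ModelSet (L K p : ℕ) where
  /-- `s ∈ par j`: the entry of `[G R H]` in row `j` and column `s` is parametrized. -/
  par : Fin L → Finset (Signal L K p)
  /-- The diagonal of `G` is known (to be zero). -/
  self_notMem : ∀ j, Sum.inl j ∉ par j
  /-- The values of the non-parametrized entries (other values of this matrix are unused). -/
  known : Matrix (Fin L) (Signal L K p) (RatFunc ℝ)
  /-- `l ∈ feed j`: the module `G_{jl}`, if parametrized, may have direct feedthrough. -/
  feed : Fin L → Finset (Fin L)
  diagNoise : Bool

namespace ModelSet

variable {L K p : ℕ} (S : ModelSet L K p)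

/-- The models in the set. -/
def models : Set (NetworkModel L K p) :=
  {M | M.IsValid ∧
    (∀ j s, s ∉ S.par j → M.entry j s = S.known j s) ∧
    (∀ j l, Sum.inl l ∈ S.par j → l ∉ S.feed j → IsStrictlyProper (M.G j l)) ∧
    (S.diagNoise = true → M.Λ.IsDiag)}

/-- `𝒴_j`: the nodes that are input to a parametrized module `G_{jk}`. -/
def Y (j : Fin L) : Finset (Fin L) := Finset.univ.filter fun k => Sum.inl k ∈ S.par j

/-- `α_j`: the number of parametrized modules that map into node `j`. -/
def α (j : Fin L) : ℕ := (S.Y j).card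

/-- `𝒰_j`: the excitations that are not input to a parametrized `R_{jk}`, `H_{jl}`. -/
def UU (j : Fin L) : Finset (Excitation K p) := Finset.univ.filter fun u => Sum.inr u ∉ S.par j

/-! ### Parameters and almost all models -/

/-- The parametrized entries of `[G R H]`. -/
abbrev ParEntry : Type := {e : Fin L × Signal L K p // e.2 ∈ S.par e.1}

/-- May the varying part of a parametrized entry be nonzero at `z = ∞`? For modules this is
prescribed by `feed`; for `R` always; for `H` only in the rows below the monic block. -/
def varFeed : Fin L × Signal L K p → Bool
  | (j, .inl l) => decide (l ∈ S.feed j)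
  | (_, .inr (.inl _)) => true
  | (j, .inr (.inr _)) => decide (p ≤ (j : ℕ))

/-- The fixed part of a parametrized entry: `1` on the diagonal of the monic block of `H`. -/
def offset : Fin L × Signal L K p → RatFunc ℝ
  | (j, .inr (.inr m)) => if (j : ℕ) = (m : ℕ) then 1 else 0
  | _ => 0

/-- Number of numerator coefficients of the varying part of an entry of order `n`: the numerator
has degree `< n`, or `≤ n` if direct feedthrough is allowed. -/
def numCoeffs (n : ℕ) (e : Fin L × Signal L K p) : ℕ := n + if S.varFeed e then 1 else 0

/-- The real parameters of the models in which the parametrized entry `e` has order `ν e`: the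
non-leading coefficients of its monic denominator, the coefficients of its numerator, and the
entries of the symmetric matrix `Λ`. -/
abbrev ParIndex (ν : S.ParEntry → ℕ) : Type :=
  (Σ e : S.ParEntry, Fin (ν e) ⊕ Fin (S.numCoeffs (ν e) e.1)) ⊕ Sym2 (Fin p)

/-- The denominator `z ^ ν_e + ∑ a_k z ^ k` of a parametrized entry. -/
def denomPoly (ν : S.ParEntry → ℕ) (θ : S.ParIndex ν → ℝ) (e : S.ParEntry) : ℝ[X] :=
  Polynomial.X ^ ν e + ∑ k : Fin (ν e),
    Polynomial.C (θ (.inl ⟨e, .inl k⟩)) * Polynomial.X ^ (k : ℕ)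

/-- The numerator `∑ b_k z ^ k` of a parametrized entry. -/
def numPoly (ν : S.ParEntry → ℕ) (θ : S.ParIndex ν → ℝ) (e : S.ParEntry) : ℝ[X] :=
  ∑ k : Fin (S.numCoeffs (ν e) e.1),
    Polynomial.C (θ (.inl ⟨e, .inr k⟩)) * Polynomial.X ^ (k : ℕ)

/-- The matrix `[G(θ) R(θ) H(θ)]`. -/
def entryAt (ν : S.ParEntry → ℕ) (θ : S.ParIndex ν → ℝ) :
    Matrix (Fin L) (Signal L K p) (RatFunc ℝ) := fun j s =>
  if h : s ∈ S.par j then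
    offset (j, s) + algebraMap ℝ[X] (RatFunc ℝ) (S.numPoly ν θ ⟨(j, s), h⟩) /
      algebraMap ℝ[X] (RatFunc ℝ) (S.denomPoly ν θ ⟨(j, s), h⟩)
  else S.known j s

/-- The quadruple `M(θ)`. -/
def modelAt (ν : S.ParEntry → ℕ) (θ : S.ParIndex ν → ℝ) : NetworkModel L K p where
  G := fun j l => S.entryAt ν θ j (.inl l)
  R := fun j k => S.entryAt ν θ j (.inr (.inl k))
  H := fun j m => S.entryAt ν θ j (.inr (.inr m))
  Λ := fun m m' => if m = m' ∨ S.diagNoise = false then θ (.inr s(m, m')) else 0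

/-- A property holds for almost all models of the set: for all choices of (positive) orders of the
parametrized entries, the coefficient vectors `θ ∈ ℝ^N` for which `M(θ)` is in the model set but
fails the property form a Lebesgue null set. -/
def ForAlmostAll (P : NetworkModel L K p → Prop) : Prop :=
  ∀ ν : S.ParEntry → ℕ, (∀ e, 1 ≤ ν e) →
    ∀ᵐ θ : S.ParIndex ν → ℝ ∂MeasureTheory.volume,
      S.modelAt ν θ ∈ S.models → P (S.modelAt ν θ)

/-! ### Identifiability -/

/-- The model set is globally network identifiable at `M₀`. -/
def NetworkIdentifiableAt (M₀ : NetworkModel L K p) : Prop :=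
  ∀ M₁ ∈ S.models, M₁.T = M₀.T → M₁.G = M₀.G ∧ M₁.R = M₀.R ∧ M₁.H = M₀.H

/-- Row `j` of the model set is globally network identifiable at `M₀`. -/
def RowIdentifiableAt (j : Fin L) (M₀ : NetworkModel L K p) : Prop :=
  ∀ M₁ ∈ S.models, M₁.T = M₀.T → M₁.G j = M₀.G j ∧ M₁.R j = M₀.R j ∧ M₁.H j = M₀.H j

/-- Module `G_{ji}` of the model set is globally network identifiable at `M₀`. -/
def ModuleIdentifiableAt (j i : Fin L) (M₀ : NetworkModel L K p) : Prop :=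
  ∀ M₁ ∈ S.models, M₁.T = M₀.T → M₁.G j i = M₀.G j i

/-! ### Rank conditions -/

/-- The submatrix of `T` with rows in `Y'` and with columns in `𝒰_j`. -/
def subT (j : Fin L) (Y' : Finset (Fin L)) (M : NetworkModel L K p) :
    Matrix Y' (S.UU j) (RatFunc ℝ) :=
  M.T.submatrix (fun a => (a : Fin L)) (fun u => (u : Excitation K p))

/-- `Ť_j`. -/
def checkT (j : Fin L) (M : NetworkModel L K p) : Matrix (S.Y j) (S.UU j) (RatFunc ℝ) :=
  S.subT j (S.Y j) M

/-- `Ť_j` with the row of node `w_i` removed. -/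
def checkTErase (j i : Fin L) (M : NetworkModel L K p) :
    Matrix ((S.Y j).erase i) (S.UU j) (RatFunc ℝ) :=
  S.subT j ((S.Y j).erase i) M

/-! ### Paths -/

/-- Signal `s` enters node `j` directly: the corresponding entry of `[G R H]` is parametrized, or is
known and nonzero. -/
def HasEdge (j : Fin L) (s : Signal L K p) : Prop := s ∈ S.par j ∨ S.known j s ≠ 0

/-- A path from an excitation through a nonempty sequence of nodes. -/
structure Path where
  source : Excitation K p
  nodes : List (Fin L)
  nodes_ne : nodes ≠ []
  source_edge : S.HasEdge (nodes.head nodes_ne) (.inr source)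
  chain : nodes.IsChain fun a b => S.HasEdge b (.inl a)

variable {S} in
/-- The node in which a path ends. -/
def Path.target (P : S.Path) : Fin L := P.nodes.getLast P.nodes_ne

variable {S} in
/-- Two paths are disjoint: they have no common node and no common excitation. -/
def Path.IsDisjoint (P Q : S.Path) : Prop :=
  P.source ≠ Q.source ∧ ∀ a ∈ P.nodes, a ∉ Q.nodes

/-- `P` is a set of `n` disjoint paths from excitations in `U'` to nodes in `Y'`. -/
def IsDisjointPaths (U' : Finset (Excitation K p)) (Y' : Finset (Fin L)) {n : ℕ}
    (P : Fin n → S.Path) : Prop :=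
  (∀ a, (P a).source ∈ U' ∧ (P a).target ∈ Y') ∧ ∀ a b, a ≠ b → (P a).IsDisjoint (P b)

/-- There is a set of `n` disjoint paths from excitations in `U'` to nodes in `Y'`. -/
def HasDisjointPaths (U' : Finset (Excitation K p)) (Y' : Finset (Fin L)) (n : ℕ) : Prop :=
  ∃ P : Fin n → S.Path, S.IsDisjointPaths U' Y' P

/-- Some maximum set of disjoint paths from `U'` to `Y'` can be extended by a further path from
`U'` to the node `i` that is disjoint to all of them. -/
def HasExtraPath (U' : Finset (Excitation K p)) (Y' : Finset (Fin L)) (i : Fin L) : Prop :=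
  ∃ (n : ℕ) (P : Fin n → S.Path), S.IsDisjointPaths U' Y' P ∧
    (∀ m, S.HasDisjointPaths U' Y' m → m ≤ n) ∧
    ∃ Q : S.Path, Q.source ∈ U' ∧ Q.target = i ∧ ∀ a, Q.IsDisjoint (P a)

/-! ### Known entries -/

/-- The entries of `[I - G, R, H]` that are not parametrized. -/
def knownSystem : Matrix (Fin L) (Signal L K p) (RatFunc ℝ) :=
  Matrix.fromCols (1 - Matrix.of fun j l => S.known j (.inl l))
    (Matrix.of fun j u => S.known j (.inr u))

/-- The known entries do not cancel: a square submatrix of `[I - G, R, H]` without parametrized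
entries is nonsingular if it has a nonzero transversal, that is, if its pattern of zeros does not
already make it singular. -/
def KnownNondegenerate : Prop :=
  ∀ (n : ℕ) (r : Fin n ↪ Fin L) (c : Fin n ↪ Signal L K p),
    (∀ a b, c b ∉ S.par (r a)) → (∀ a, S.knownSystem (r a) (c a) ≠ 0) →
      (S.knownSystem.submatrix r c).det ≠ 0

end ModelSet

end DynNet

end

/-!
Let `A = I - G`, so that `T = A⁻¹ U`. Identifiability is compared with rank at each model, and rank
with paths at almost every model.

*Identifiability and rank.* The rows `j` of `G` in two models with the same `T` differ by a vector
`x` supported on `𝒴_j` with `x T = 0` on the columns `𝒰_j`. So row `j` is determined if the left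
kernel of `Ť_j` is trivial, and `G_{ji}` is determined if all vectors of the kernel vanish at `i`.
Conversely, a vector of the kernel can be scaled to be stable, strictly proper and so small that its
addition to row `j` of `G`, compensated in row `j` of `U`, gives another model of the set with the
same `T` (`addRow_mem_models`, `exists_model_same_T`). This yields `rowIdentifiableAt_iff` and
`moduleIdentifiableAt_iff`, which hold at every single model.

*Rank and determinants.* A minor of `T` with rows `Y` is, up to the factor `det A`, the determinant
of `A` with the columns `Y` exchanged for columns of `U` (`det_link`). A transversal of nonzero
entries of such a matrix is a family of disjoint paths that end in `Y`, and conversely: a path is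
followed by iterating the permutation until an exchanged column is met
(`hasDisjointPaths_of_isTransversal`), and disjoint simple paths become cycles of a permutation
(`HasDisjointPaths.exists_isTransversal`). Hence in every model the rank of a submatrix of `T` is at
most the maximal number of disjoint paths (`hasDisjointPaths_rank`).

*Generic equality.* For the converse a transversal must give a determinant that does not vanish
identically in the parameters. If the fixed entries do not cancel, this holds by induction on
the size (`exists_completion_det_ne_zero`): a free entry on some transversal serves for expansion,
and if no transversal passes through a free entry, Hall's theorem gives a block triangular form with
smaller blocks. A determinant that is nonzero for one parameter vector is nonzero for almost all of
them, because the zero set of a nonzero polynomial is a null set (`ae_ne_zero_of_ratFamilies`).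

*Almost all is not vacuous.* Conditions on almost all models can be refuted by a property of all
models only if valid parameter vectors are not a null set. They contain a nonempty open set
(`exists_eventually_mem_models`). In the variable `z⁻¹`, a function is proper and stable if it is a
quotient of polynomials whose denominator has no zeros in the closed unit disc
(`isProper_and_isStable_iff`); the disc is compact, so this condition, and with it each
requirement on a model, persists under small changes of the coefficients.
-/

namespace DynNet

/-! ### Determinants of matrices with free and fixed entries -/

open Matrix in
theorem det_sub_det_of_eq_off_diag {F ι : Type*} [CommRing F] [Fintype ι] [DecidableEq ι]
    (M N : Matrix ι ι F) (a : ι) (h : ∀ i j, (i, j) ≠ (a, a) → N i j = M i j) :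
    N.det - M.det = (N a a - M a a) *
      (M.submatrix (Subtype.val : {x // x ≠ a} → ι) Subtype.val).det := by
  have hN : N = M.updateRow a (M a + Pi.single a (N a a - M a a)) := by
    ext i j
    by_cases hi : i = a
    · subst hi
      by_cases hj : j = i
      · subst hj; simp
      · simp [hj, h i j (by simp [hj])]
    · rw [updateRow_ne hi]; exact h i j (by simp [hi])
  have hM : M.updateRow a (M a) = M := updateRow_eq_self M a
  conv_lhs => rw [hN]
  rw [det_updateRow_add, hM, add_sub_cancel_left,
    twoBlockTriangular_det' _ (fun i => i = a)]
  · congr 1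
    · have : Subsingleton {i // i = a} := ⟨fun x y => Subtype.ext (x.2.trans y.2.symm)⟩
      have h1 := det_eq_elem_of_subsingleton
        (toSquareBlockProp (M.updateRow a (Pi.single a (N a a - M a a))) (· = a)) ⟨a, rfl⟩
      convert! h1 using 1 <;> simp [toSquareBlockProp]
    · congr 1
      ext i j
      simp only [toSquareBlockProp_def, of_apply, submatrix_apply]
      rw [updateRow_ne i.2]
  · rintro i rfl j hj
    simp [hj]

/-- If some position `(a, b)` lies on no perfect matching of a bipartite graph that contains the
diagonal, then the graph has a closed set of rows containing `b` and not `a`: the obstruction to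
Hall's condition, which the diagonal forces to be closed. -/
theorem exists_perm_or_closed {ι : Type*} [Fintype ι] [DecidableEq ι] (E : ι → ι → Prop)
    (hE : ∀ a, E a a) (a b : ι) (hab : E a b) :
    (∃ σ : Equiv.Perm ι, σ a = b ∧ ∀ x, E x (σ x)) ∨
      ∃ S : Finset ι, b ∈ S ∧ a ∉ S ∧ ∀ x ∈ S, ∀ y, E x y → y ∈ S := by
  classical
  let t : ι → Finset ι := fun x => if x = a then {b} else (Finset.univ.filter (E x)).erase b
  by_cases hall : ∀ s : Finset ι, s.card ≤ (s.biUnion t).card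
  · left
    obtain ⟨f, hf, hft⟩ := (Finset.all_card_le_biUnion_card_iff_exists_injective t).1 hall
    have hfa : f a = b := by simpa [t] using hft a
    refine ⟨Equiv.ofBijective f hf.bijective_of_finite, hfa, fun x => ?_⟩
    by_cases hx : x = a
    · subst hx; simpa [hfa] using hab
    · have := hft x
      simp [t, hx] at this
      exact this.2
  · right
    push Not at hall
    obtain ⟨s, hs⟩ := hall
    -- Dropping `a` from a violator of Hall's condition leaves a violator.
    have hS : ((s.erase a).biUnion t).card < (s.erase a).card := by
      by_cases ha : a ∈ s
      · have h1 : s.biUnion t = insert b ((s.erase a).biUnion t) := by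
          conv_lhs => rw [← Finset.insert_erase ha, Finset.biUnion_insert]
          rw [Finset.insert_eq, show t a = {b} from if_pos rfl]
        have h2 : b ∉ (s.erase a).biUnion t := by
          simp only [Finset.mem_biUnion, not_exists, not_and, Finset.mem_erase]
          intro x hx
          simp [t, hx.1]
        rw [h1, Finset.card_insert_of_notMem h2] at hs
        rw [Finset.card_erase_of_mem ha]
        omega
      · rwa [Finset.erase_eq_of_notMem ha]
    set S := s.erase a with hSdef
    have haS : a ∉ S := by simp [hSdef]
    have hsub : S.erase b ⊆ S.biUnion t := by
      intro x hx
      rw [Finset.mem_erase] at hx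
      refine Finset.mem_biUnion.2 ⟨x, hx.2, ?_⟩
      have : x ≠ a := fun h => haS (h ▸ hx.2)
      simp [t, this, hx.1, hE]
    have hbS : b ∈ S := by
      by_contra hb
      rw [Finset.erase_eq_of_notMem hb] at hsub
      exact absurd (Finset.card_le_card hsub) (by omega)
    have heq : S.erase b = S.biUnion t := by
      apply Finset.eq_of_subset_of_card_le hsub
      rw [Finset.card_erase_of_mem hbS]; omega
    refine ⟨S, hbS, haS, fun x hx y hxy => ?_⟩
    by_cases hy : y = b
    · rwa [hy]
    · have : y ∈ S.biUnion t := by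
        refine Finset.mem_biUnion.2 ⟨x, hx, ?_⟩
        have : x ≠ a := fun h => haS (h ▸ hx)
        simp [t, this, hy, hxy]
      rw [← heq] at this
      exact Finset.mem_of_mem_erase this

/-- `B` is a completion of a partially prescribed matrix: a fixed entry (`par` is false) has its
known value, a free entry one of two values. -/
def IsCompletion {ρ κ F : Type*} (par : ρ → κ → Prop) (known v₀ v₁ : ρ → κ → F)
    (B : ρ → κ → F) : Prop :=
  ∀ i s, (¬ par i s → B i s = known i s) ∧ (par i s → B i s = v₀ i s ∨ B i s = v₁ i s)

section

variable {ρ κ F : Type*} [Field F] {par : ρ → κ → Prop} {known v₀ v₁ : ρ → κ → F}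

/-- A free entry on the diagonal can be used for expansion: the determinant is affine in it, and its
slope is the complementary minor. -/
theorem exists_completion_det_ne_zero_of_par_diag (hv : ∀ i s, par i s → v₀ i s ≠ v₁ i s)
    {ι : Type} [Fintype ι] [DecidableEq ι] (r : ι ↪ ρ) (c : ι ↪ κ) (a : ι) (ha : par (r a) (c a))
    (hminor : ∃ B, IsCompletion par known v₀ v₁ B ∧
      (Matrix.of fun x y : {x // x ≠ a} => B (r x) (c y)).det ≠ 0) :
    ∃ B, IsCompletion par known v₀ v₁ B ∧ (Matrix.of fun x y => B (r x) (c y)).det ≠ 0 := by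
  classical
  obtain ⟨B, hB, hdet⟩ := hminor
  let B' : F → ρ → κ → F := fun t i s => if i = r a ∧ s = c a then t else B i s
  have hB' : ∀ t, (t = v₀ (r a) (c a) ∨ t = v₁ (r a) (c a)) →
      IsCompletion par known v₀ v₁ (B' t) := by
    intro t ht i s
    by_cases h : i = r a ∧ s = c a
    · obtain ⟨rfl, rfl⟩ := h
      simpa [B', ha] using ht
    · simpa [B', h] using hB i s
  have key := det_sub_det_of_eq_off_diag
    (Matrix.of fun x y => B' (v₀ (r a) (c a)) (r x) (c y))
    (Matrix.of fun x y => B' (v₁ (r a) (c a)) (r x) (c y)) a (by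
      intro i j hij
      have : ¬ (r i = r a ∧ c j = c a) := by
        rintro ⟨h1, h2⟩
        exact hij (by rw [r.injective h1, c.injective h2])
      simp only [Matrix.of_apply, B', if_neg this])
  have hm : ((Matrix.of fun x y => B' (v₀ (r a) (c a)) (r x) (c y)).submatrix
      (Subtype.val : {x // x ≠ a} → ι) Subtype.val) =
      Matrix.of fun x y : {x // x ≠ a} => B (r x) (c y) := by
    ext x y
    have : ¬ (r x = r a ∧ c y = c a) := fun h => x.2 (r.injective h.1)
    simp only [Matrix.of_apply, Matrix.submatrix_apply, B', if_neg this]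
  rw [hm] at key
  by_cases h0 : (Matrix.of fun x y => B' (v₀ (r a) (c a)) (r x) (c y)).det = 0
  · refine ⟨_, hB' _ (Or.inr rfl), ?_⟩
    rw [h0, sub_zero] at key
    rw [key]
    refine mul_ne_zero ?_ hdet
    simp only [Matrix.of_apply, B', and_self, if_true]
    exact sub_ne_zero.2 (hv _ _ ha).symm
  · exact ⟨_, hB' _ (Or.inl rfl), h0⟩

/-- Suppose that the fixed entries do not cancel. Then a square matrix with a transversal
of entries that are free or nonzero has a nonsingular completion. By induction on the size: a free
entry on some transversal serves for expansion, and a free entry on no transversal sits off the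
diagonal blocks of a block triangular form. -/
theorem exists_completion_det_ne_zero (hv : ∀ i s, par i s → v₀ i s ≠ v₁ i s)
    (hknown : ∀ (n : ℕ) (r : Fin n ↪ ρ) (c : Fin n ↪ κ), (∀ a b, ¬ par (r a) (c b)) →
      (∀ a, known (r a) (c a) ≠ 0) → (Matrix.of fun a b => known (r a) (c b)).det ≠ 0)
    {ι : Type} [Fintype ι] [DecidableEq ι] (r : ι ↪ ρ) (c : ι ↪ κ)
    (hdiag : ∀ a, par (r a) (c a) ∨ known (r a) (c a) ≠ 0) :
    ∃ B, IsCompletion par known v₀ v₁ B ∧ (Matrix.of fun x y => B (r x) (c y)).det ≠ 0 := by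
  classical
  induction hn : Fintype.card ι using Nat.strong_induction_on generalizing ι with
  | _ n ih =>
  subst hn
  by_cases hpar : ∃ a b, par (r a) (c b)
  · obtain ⟨a, b, hab⟩ := hpar
    obtain ⟨σ, hσab, hσ⟩ | ⟨S, hbS, haS, hS⟩ := exists_perm_or_closed
      (fun x y => par (r x) (c y) ∨ known (r x) (c y) ≠ 0) hdiag a b (Or.inl hab)
    · let c' : ι ↪ κ := σ.toEmbedding.trans c
      obtain ⟨B, hB, hdet⟩ := exists_completion_det_ne_zero_of_par_diag
        (known := known) hv r c' a (by simpa [c', hσab] using hab) (by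
          refine ih (Fintype.card {x // x ≠ a}) ?_
            ((Function.Embedding.subtype _).trans r) ((Function.Embedding.subtype _).trans c')
            (fun x => hσ x) rfl
          exact Fintype.card_subtype_lt (x := a) (by simp))
      refine ⟨B, hB, fun h => hdet ?_⟩
      have := Matrix.det_permute' σ (Matrix.of fun x y => B (r x) (c y))
      rw [h, mul_zero] at this
      exact this
    · obtain ⟨B₁, hB₁, hd₁⟩ := ih (Fintype.card {x // x ∈ S})
        (Fintype.card_subtype_lt (x := a) haS)
        ((Function.Embedding.subtype _).trans r) ((Function.Embedding.subtype _).trans c)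
        (fun x => hdiag x) rfl
      obtain ⟨B₂, hB₂, hd₂⟩ := ih (Fintype.card {x // x ∉ S})
        (Fintype.card_subtype_lt (x := b) (by simpa using hbS))
        ((Function.Embedding.subtype _).trans r) ((Function.Embedding.subtype _).trans c)
        (fun x => hdiag x) rfl
      -- The two diagonal blocks lie in different rows, so they can be completed separately.
      let B : ρ → κ → F := fun i s => if ∃ x ∈ S, r x = i then B₁ i s else B₂ i s
      have hB : IsCompletion par known v₀ v₁ B := by
        intro i s
        by_cases h : ∃ x ∈ S, r x = i
        · simpa only [B, if_pos h] using hB₁ i s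
        · simpa only [B, if_neg h] using hB₂ i s
      have hBS : ∀ x ∈ S, ∀ s, B (r x) s = B₁ (r x) s := fun x hx s => by
        simp only [B]; rw [if_pos ⟨x, hx, rfl⟩]
      have hBS' : ∀ x ∉ S, ∀ s, B (r x) s = B₂ (r x) s := fun x hx s => by
        simp only [B]; rw [if_neg]
        rintro ⟨y, hy, hyx⟩
        exact hx (r.injective hyx ▸ hy)
      refine ⟨B, hB, ?_⟩
      rw [Matrix.twoBlockTriangular_det' _ (fun i => i ∈ S)]
      · refine mul_ne_zero ?_ ?_
        · convert hd₁ using 2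
          ext x y
          exact hBS x x.2 _
        · convert hd₂ using 2
          ext x y
          exact hBS' x x.2 _
      · intro i hi j hj
        have hij : ¬ (par (r i) (c j) ∨ known (r i) (c j) ≠ 0) := fun h => hj (hS i hi j h)
        push Not at hij
        simp only [Matrix.of_apply]
        rw [(hB (r i) (c j)).1 hij.1, hij.2]
  · push Not at hpar
    have e := (Fintype.equivFin ι).symm
    have h := hknown (Fintype.card ι) (e.toEmbedding.trans r) (e.toEmbedding.trans c)
      (fun a b => hpar _ _) (fun a => (hdiag (e a)).resolve_left (hpar _ _))
    refine ⟨fun i s => if par i s then v₀ i s else known i s, fun i s => ?_, ?_⟩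
    · by_cases hp : par i s <;> simp [hp]
    · rw [← Matrix.det_submatrix_equiv_self e]
      convert h using 2
      ext x y
      simp [hpar]

end

/-! ### Disjoint paths and transversals -/

/-- A walk can be shortened to a simple one with the same end points. -/
theorem exists_nodup_isChain {β : Type*} {r : β → β → Prop} (l : List β) (hl : l.IsChain r) :
    ∃ l' : List β, l'.Nodup ∧ l'.IsChain r ∧ l'.head? = l.head? ∧ l'.getLast? = l.getLast? ∧
      l' ⊆ l := by
  induction l with
  | nil => exact ⟨[], by simp⟩
  | cons x t ih =>
    obtain ⟨t', hnd, hch, hhead, hlast, hsub⟩ := ih hl.tail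
    rcases eq_or_ne t [] with rfl | ht
    · exact ⟨[x], by simp⟩
    have hlast' : (x :: t).getLast? = t.getLast? := by
      obtain ⟨y, t₀, rfl⟩ := List.exists_cons_of_ne_nil ht
      rw [List.getLast?_cons_cons]
    by_cases hx : x ∈ t'
    · -- Cut out the loop at `x`.
      obtain ⟨s, r', rfl⟩ := List.append_of_mem hx
      refine ⟨x :: r', (List.nodup_append.1 hnd).2.1, (List.isChain_append.1 hch).2.1, rfl, ?_, ?_⟩
      · rw [hlast', ← hlast, List.getLast?_append_cons]
      · intro z hz
        exact List.mem_cons_of_mem _ (hsub (List.mem_append_right _ hz))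
    · refine ⟨x :: t', List.nodup_cons.2 ⟨hx, hnd⟩, ?_, rfl, ?_, ?_⟩
      · rw [List.isChain_cons] at hl ⊢
        exact ⟨by rw [hhead]; exact hl.1, hch⟩
      · rw [hlast', ← hlast]
        have : t' ≠ [] := by
          rintro rfl
          exact ht (List.getLast?_eq_none_iff.1 hlast.symm)
        obtain ⟨a, b, rfl⟩ := List.exists_cons_of_ne_nil this
        simp
      · intro z hz
        rcases List.mem_cons.1 hz with rfl | hz
        · exact List.mem_cons_self
        · exact List.mem_cons_of_mem _ (hsub hz)

namespace ModelSet

variable {L K p : ℕ} {S : ModelSet L K p}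

theorem Path.exists_nodup (P : S.Path) :
    ∃ Q : S.Path, Q.nodes.Nodup ∧ Q.source = P.source ∧ Q.target = P.target ∧
      Q.nodes ⊆ P.nodes := by
  obtain ⟨l, hnd, hch, hhead, hlast, hsub⟩ := exists_nodup_isChain P.nodes P.chain
  have hne : l ≠ [] := by
    rintro rfl
    exact P.nodes_ne (List.head?_eq_none_iff.1 hhead.symm)
  rw [List.head?_eq_some_head hne, List.head?_eq_some_head P.nodes_ne, Option.some_inj] at hhead
  rw [List.getLast?_eq_some_getLast hne, List.getLast?_eq_some_getLast P.nodes_ne,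
    Option.some_inj] at hlast
  exact ⟨⟨P.source, l, hne, hhead ▸ P.source_edge, hch⟩, hnd, rfl, hlast, hsub⟩

theorem Path.target_mem (P : S.Path) : P.target ∈ P.nodes := List.getLast_mem _

/-- A selection of `L` columns of `[I - G, R, H]`: the column of a node `v`, unless `v` belongs to
`Y'` and its column is exchanged for that of an excitation in `U'`. -/
structure IsLink (U' : Finset (Excitation K p)) (Y' : Finset (Fin L))
    (c : Fin L → Signal L K p) : Prop where
  injective : Function.Injective c
  cases : ∀ v, c v = .inl v ∨ v ∈ Y' ∧ ∃ u ∈ U', c v = .inr u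

/-- The number of exchanged columns. -/
def linkCard (c : Fin L → Signal L K p) : ℕ := (Finset.univ.filter fun v => c v ≠ .inl v).card

variable (S) in
/-- The selected columns have a transversal of entries of `[I - G, R, H]` that are parametrized or
nonzero: the entry in column `c v` is taken from row `σ v`. -/
def IsTransversal (c : Fin L → Signal L K p) (σ : Equiv.Perm (Fin L)) : Prop :=
  ∀ v, c v = .inl (σ v) ∨ S.HasEdge (σ v) (c v)

/-- The path that starts with the excitation exchanged for `v` and follows `σ` until the first
return to an exchanged column. -/
theorem exists_path_of_isTransversal {U' : Finset (Excitation K p)} {Y' : Finset (Fin L)}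
    {c : Fin L → Signal L K p} (hc : IsLink U' Y' c) {σ : Equiv.Perm (Fin L)}
    (hσ : S.IsTransversal c σ) (v : Fin L) (hv : c v ≠ .inl v) :
    ∃ P : S.Path, .inr P.source = c v ∧ P.target ∈ Y' ∧
      ∃ k : ℕ, (∀ i < k, c ((σ ^ (i + 1)) v) = .inl ((σ ^ (i + 1)) v)) ∧
        ∀ a, a ∈ P.nodes ↔ ∃ i ≤ k, (σ ^ (i + 1)) v = a := by
  classical
  have hret : ∃ k : ℕ, c ((σ ^ (k + 1)) v) ≠ .inl ((σ ^ (k + 1)) v) := by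
    refine ⟨orderOf σ - 1, ?_⟩
    rwa [Nat.sub_add_cancel (orderOf_pos σ), pow_orderOf_eq_one]
  set k := Nat.find hret with hk
  have hlt : ∀ i < k, c ((σ ^ (i + 1)) v) = .inl ((σ ^ (i + 1)) v) :=
    fun i hi => not_not.1 (Nat.find_min hret hi)
  obtain ⟨-, u, -, hu⟩ := (hc.cases v).resolve_left hv
  have hne : (List.range (k + 1)).map (fun i => (σ ^ (i + 1)) v) ≠ [] := by simp
  refine ⟨⟨u, (List.range (k + 1)).map fun i => (σ ^ (i + 1)) v, hne, ?_, ?_⟩, hu.symm, ?_, k, hlt,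
    ?_⟩
  · rw [← hu]
    simp only [List.head_map, List.head_range, zero_add, pow_one]
    refine (hσ v).resolve_left ?_
    rw [hu]; simp
  · rw [List.isChain_map, List.isChain_iff_getElem]
    intro i hi
    simp only [List.length_range] at hi
    simp only [List.getElem_range]
    have h1 := hlt i (by omega)
    have h2 := hσ ((σ ^ (i + 1)) v)
    rw [h1, ← Equiv.Perm.mul_apply, ← pow_succ'] at h2
    refine h2.resolve_left fun h3 => ?_
    -- A fixed point of `σ` cannot be reached from `v`.
    rw [Sum.inl.injEq, pow_succ σ (i + 1), Equiv.Perm.mul_apply,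
      (σ ^ (i + 1)).injective.eq_iff] at h3
    have h4 : (σ ^ (i + 1)) v = v := by
      have h3' : Function.IsFixedPt σ v := h3.symm
      rw [Equiv.Perm.coe_pow]
      exact h3'.iterate (i + 1)
    rw [h4] at h1
    exact hv h1
  · simp only [Path.target, List.getLast_map, List.getLast_range]
    rw [Nat.add_sub_cancel]
    exact ((hc.cases _).resolve_left (Nat.find_spec hret)).1
  · intro a
    simp

/-- The paths that start with different exchanged excitations are segments of orbits of `σ` between
consecutive exchanged columns, hence disjoint. -/
theorem hasDisjointPaths_of_isTransversal {U' : Finset (Excitation K p)} {Y' : Finset (Fin L)}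
    {c : Fin L → Signal L K p} (hc : IsLink U' Y' c) {σ : Equiv.Perm (Fin L)}
    (hσ : S.IsTransversal c σ) : S.HasDisjointPaths U' Y' (linkCard c) := by
  classical
  set Z := Finset.univ.filter fun v => c v ≠ .inl v with hZ
  have hmem : ∀ v : Z, c v ≠ .inl (v : Fin L) := fun v =>
    (Finset.mem_filter.1 v.2).2
  choose P hsrc htgt k hk hnodes using fun v : Z => exists_path_of_isTransversal hc hσ v (hmem v)
  let e : Fin (linkCard c) ≃ Z := Z.equivFin.symm
  -- Two orbits that meet before their first returns start at the same node.
  have key : ∀ v w : Z, ∀ i j, i ≤ j → j ≤ k w →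
      (σ ^ (i + 1)) (v : Fin L) = (σ ^ (j + 1)) (w : Fin L) → v = w := by
    intro v w i j hij hj h
    obtain ⟨d, rfl⟩ := Nat.exists_eq_add_of_le hij
    rw [show i + d + 1 = (i + 1) + d by ring, pow_add _ (i + 1), Equiv.Perm.mul_apply,
      (σ ^ (i + 1)).injective.eq_iff] at h
    rcases d with _ | d
    · exact Subtype.ext (by simpa using h)
    · have := hk w d (by omega)
      rw [← h] at this
      exact absurd this (hmem v)
  refine ⟨fun a => P (e a), fun a => ⟨?_, htgt _⟩, fun a b hab => ⟨fun h => ?_, ?_⟩⟩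
  · obtain ⟨-, u, hu, hcu⟩ := (hc.cases (e a)).resolve_left (hmem _)
    have := hsrc (e a)
    rw [hcu, Sum.inr.injEq] at this
    rwa [this]
  · have h1 : c (e a) = c (e b) := by rw [← hsrc, ← hsrc, h]
    exact hab (e.injective (Subtype.ext (hc.injective h1)))
  · intro x hxa hxb
    obtain ⟨i, hi, hia⟩ := (hnodes _ _).1 hxa
    obtain ⟨j, hj, hjb⟩ := (hnodes _ _).1 hxb
    apply hab
    rcases le_total i j with hij | hij
    · exact e.injective (key _ _ i j hij hj (hia.trans hjb.symm))
    · exact e.injective (key _ _ j i hij hi (hjb.trans hia.symm)).symm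

/-- The columns of the targets are exchanged for those of the sources; `σ` rotates each simple path
cyclically and fixes all other nodes. -/
theorem HasDisjointPaths.exists_isTransversal {U' : Finset (Excitation K p)} {Y' : Finset (Fin L)}
    {n : ℕ} (h : S.HasDisjointPaths U' Y' n) :
    ∃ c : Fin L → Signal L K p, IsLink U' Y' c ∧ linkCard c = n ∧ ∃ σ, S.IsTransversal c σ := by
  classical
  obtain ⟨P₀, hP₀, hdis₀⟩ := h
  choose P hnd hsrc htgt hsub using fun a => (P₀ a).exists_nodup
  have hU : ∀ a, (P a).source ∈ U' := fun a => hsrc a ▸ (hP₀ a).1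
  have hY : ∀ a, (P a).target ∈ Y' := fun a => htgt a ▸ (hP₀ a).2
  have hs : ∀ a b, (P a).source = (P b).source → a = b := fun a b hab => by
    by_contra hne
    exact (hdis₀ a b hne).1 (by rw [← hsrc, ← hsrc, hab])
  have hd : ∀ a b x, x ∈ (P a).nodes → x ∈ (P b).nodes → a = b := fun a b x hxa hxb => by
    by_contra hne
    exact (hdis₀ a b hne).2 x (hsub a hxa) (hsub b hxb)
  have ht : ∀ a b, (P a).target = (P b).target → a = b := fun a b hab =>
    hd a b _ (P a).target_mem (hab ▸ (P b).target_mem)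
  let c : Fin L → Signal L K p := fun v =>
    if h : ∃ a, (P a).target = v then .inr (P h.choose).source else .inl v
  have hc₁ : ∀ a, c (P a).target = .inr (P a).source := fun a => by
    have h : ∃ b, (P b).target = (P a).target := ⟨a, rfl⟩
    simp only [c]
    rw [dif_pos h, ht _ _ h.choose_spec]
  have hc₂ : ∀ v, (∀ a, (P a).target ≠ v) → c v = .inl v := fun v h => by
    simp only [c]
    rw [dif_neg (by simpa using h)]
  let f : Fin L → Fin L := fun v =>
    if h : ∃ a, v ∈ (P a).nodes then (P h.choose).nodes.formPerm v else v
  have hf₁ : ∀ a v, v ∈ (P a).nodes → f v = (P a).nodes.formPerm v := fun a v hv => by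
    have h : ∃ b, v ∈ (P b).nodes := ⟨a, hv⟩
    simp only [f]
    rw [dif_pos h, hd _ _ _ h.choose_spec hv]
  have hf₂ : ∀ v, (∀ a, v ∉ (P a).nodes) → f v = v := fun v h => by
    simp only [f]
    rw [dif_neg (by simpa using h)]
  have hfmem : ∀ a v, v ∈ (P a).nodes → f v ∈ (P a).nodes := fun a v hv => by
    rw [hf₁ a v hv]; exact List.formPerm_apply_mem_of_mem hv
  have hfinj : Function.Injective f := by
    intro v w hvw
    by_cases hv : ∃ a, v ∈ (P a).nodes
    · obtain ⟨a, ha⟩ := hv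
      by_cases hw : ∃ b, w ∈ (P b).nodes
      · obtain ⟨b, hb⟩ := hw
        have hab : a = b := hd a b (f v) (hfmem a v ha) (hvw ▸ hfmem b w hb)
        subst hab
        rw [hf₁ a v ha, hf₁ a w hb] at hvw
        exact (List.formPerm _).injective hvw
      · push Not at hw
        rw [hf₂ w hw] at hvw
        exact absurd (hvw ▸ hfmem a v ha) (hw a)
    · push Not at hv
      by_cases hw : ∃ b, w ∈ (P b).nodes
      · obtain ⟨b, hb⟩ := hw
        rw [hf₂ v hv] at hvw
        exact absurd (hvw ▸ hfmem b w hb) (hv b)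
      · push Not at hw
        rwa [hf₂ v hv, hf₂ w hw] at hvw
  refine ⟨c, ⟨?_, ?_⟩, ?_, Equiv.ofBijective f hfinj.bijective_of_finite, ?_⟩
  · intro v w hvw
    by_cases hv : ∃ a, (P a).target = v <;> by_cases hw : ∃ b, (P b).target = w
    · obtain ⟨a, rfl⟩ := hv
      obtain ⟨b, rfl⟩ := hw
      rw [hc₁, hc₁, Sum.inr.injEq] at hvw
      rw [hs a b hvw]
    · obtain ⟨a, rfl⟩ := hv
      push Not at hw
      rw [hc₁, hc₂ w hw] at hvw
      simp at hvw
    · obtain ⟨a, rfl⟩ := hw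
      push Not at hv
      rw [hc₁, hc₂ v hv] at hvw
      simp at hvw
    · push Not at hv hw
      rw [hc₂ v hv, hc₂ w hw] at hvw
      exact Sum.inl.inj hvw
  · intro v
    by_cases hv : ∃ a, (P a).target = v
    · obtain ⟨a, rfl⟩ := hv
      exact Or.inr ⟨hY a, _, hU a, hc₁ a⟩
    · push Not at hv
      exact Or.inl (hc₂ v hv)
  · have : (Finset.univ.filter fun v => c v ≠ .inl v) =
        Finset.univ.image fun a => (P a).target := by
      ext v
      simp only [Finset.mem_filter, Finset.mem_univ, true_and, Finset.mem_image]
      constructor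
      · intro h
        by_contra h'
        push Not at h'
        exact h (hc₂ v h')
      · rintro ⟨a, rfl⟩
        rw [hc₁]; simp
    rw [linkCard, this, Finset.card_image_of_injective _ (fun a b h => ht a b h)]
    simp
  · intro v
    simp only [Equiv.ofBijective_apply]
    by_cases hv : ∃ a, v ∈ (P a).nodes
    · right
      obtain ⟨a, ha⟩ := hv
      rw [hf₁ a v ha]
      obtain ⟨i, hi, rfl⟩ := List.getElem_of_mem ha
      have htl : (P a).target = (P a).nodes[(P a).nodes.length - 1]'(by omega) := by
        rw [Path.target, List.getLast_eq_getElem]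
      rw [List.formPerm_apply_getElem _ (hnd a)]
      by_cases hlast : i + 1 = (P a).nodes.length
      · have h1 : (P a).nodes[i] = (P a).target := by
          rw [htl]; congr 1; omega
        rw [h1, hc₁]
        have := (P a).source_edge
        rw [List.head_eq_getElem] at this
        convert this using 2
        simp [hlast]
      · have hi' : i + 1 < (P a).nodes.length := by omega
        have h1 : ∀ b, (P b).target ≠ (P a).nodes[i] := fun b hb => by
          have hba : b = a := hd b a _ (P b).target_mem (hb ▸ ha)
          subst hba
          rw [htl, (hnd b).getElem_inj_iff] at hb
          omega
        rw [hc₂ _ h1]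
        have := (List.isChain_iff_getElem.1 (P a).chain) i hi'
        convert this using 2
        exact Nat.mod_eq_of_lt hi'
    · push Not at hv
      left
      rw [hf₂ v hv]
      refine hc₂ v fun a ha => hv a (ha ▸ (P a).target_mem)

end ModelSet

/-! ### Minors of the transfer matrix -/

section

variable {F : Type*} [Field F]

theorem exists_submatrix_det_ne_zero {m n : Type} [Fintype m] [Fintype n] (A : Matrix m n F) :
    ∃ (r : Fin A.rank ↪ m) (c : Fin A.rank ↪ n), (A.submatrix r c).det ≠ 0 := by
  classical
  obtain ⟨κ, a, ha, hspan, hli⟩ := exists_linearIndependent' F A.row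
  have : Fintype κ := Fintype.ofInjective a ha
  set B := A.submatrix a id with hB
  have hrow : B.row = A.row ∘ a := rfl
  have hBrank : B.rank = A.rank := by
    rw [Matrix.rank_eq_finrank_span_row, Matrix.rank_eq_finrank_span_row, hrow, hspan]
  have hκ : Fintype.card κ = A.rank := by
    rw [Matrix.rank_eq_finrank_span_row, ← hspan, finrank_span_eq_card hli]
  obtain ⟨κ', b, hb, hspan', hli'⟩ := exists_linearIndependent' F B.col
  have : Fintype κ' := Fintype.ofInjective b hb
  have hκ' : Fintype.card κ' = A.rank := by
    rw [← hBrank, Matrix.rank_eq_finrank_span_cols, ← hspan', finrank_span_eq_card hli']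
  let e : Fin A.rank ≃ κ := (Fintype.equivFinOfCardEq hκ).symm
  let e' : Fin A.rank ≃ κ' := (Fintype.equivFinOfCardEq hκ').symm
  refine ⟨e.toEmbedding.trans ⟨a, ha⟩, e'.toEmbedding.trans ⟨b, hb⟩, ?_⟩
  have h1 : IsUnit (B.submatrix e (b ∘ e')) := by
    rw [← Matrix.linearIndependent_cols_iff_isUnit]
    have h2 : LinearIndependent F (B.col ∘ b ∘ e') := hli'.comp e' e'.injective
    have h3 := h2.map' (LinearMap.funLeft F F e) (LinearMap.ker_eq_bot.2
      (LinearMap.funLeft_injective_of_surjective F F e e.surjective))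
    exact h3
  rw [Matrix.isUnit_iff_isUnit_det] at h1
  exact h1.ne_zero

variable {L K p : ℕ}

/-- Exchanging columns of `A` for columns of `U` multiplies `det A` by a minor of `A⁻¹ U`. -/
theorem det_link {A : Matrix (Fin L) (Fin L) F} (hA : A.det ≠ 0)
    (U : Matrix (Fin L) (Excitation K p) F) {c : Fin L → Signal L K p}
    (u : {v // c v ≠ .inl v} → Excitation K p)
    (hu : ∀ v : {v // c v ≠ .inl v}, c v = .inr (u v)) :
    ((Matrix.fromCols A U).submatrix id c).det =
      A.det * ((A⁻¹ * U).submatrix Subtype.val u).det := by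
  have h1 : Matrix.fromCols A U = A * Matrix.fromCols 1 (A⁻¹ * U) := by
    rw [Matrix.mul_fromCols, Matrix.mul_one, Matrix.mul_nonsing_inv_cancel_left _ _ hA.isUnit]
  have h2 : (Matrix.fromCols A U).submatrix id c =
      A * (Matrix.fromCols 1 (A⁻¹ * U)).submatrix id c := by
    rw [h1]; rfl
  rw [h2, Matrix.det_mul]
  congr 1
  rw [Matrix.twoBlockTriangular_det' _ (fun v => c v ≠ .inl v)]
  · have h3 : (Matrix.toSquareBlockProp ((Matrix.fromCols (1 : Matrix (Fin L) (Fin L) F)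
        (A⁻¹ * U)).submatrix id c) fun v => ¬ c v ≠ .inl v) = 1 := by
      ext v w
      have hw : c w = .inl (w : Fin L) := not_not.1 w.2
      simp only [Matrix.toSquareBlockProp_def, Matrix.of_apply, Matrix.submatrix_apply, hw,
        Matrix.fromCols_apply_inl, id, Matrix.one_apply, Subtype.ext_iff]
    rw [h3, Matrix.det_one, mul_one]
    congr 1
    ext v w
    simp only [Matrix.toSquareBlockProp_def, Matrix.of_apply, Matrix.submatrix_apply, hu w,
      Matrix.fromCols_apply_inr, id]
  · intro v hv w hw
    have hw' : c w = .inl w := not_not.1 hw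
    simp only [Matrix.submatrix_apply, hw', Matrix.fromCols_apply_inl, id]
    exact Matrix.one_apply_ne fun h => hw (h ▸ hv)

/-- A nonsingular exchange of columns exhibits a nonzero minor of `A⁻¹ U` of size `linkCard c`. -/
theorem linkCard_le_rank {U' : Finset (Excitation K p)} {Y' : Finset (Fin L)}
    {A : Matrix (Fin L) (Fin L) F} (hA : A.det ≠ 0)
    (U : Matrix (Fin L) (Excitation K p) F) {c : Fin L → Signal L K p}
    (hc : ModelSet.IsLink U' Y' c) (hdet : ((Matrix.fromCols A U).submatrix id c).det ≠ 0) :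
    ModelSet.linkCard c ≤ ((A⁻¹ * U).submatrix (fun a : Y' => (a : Fin L))
      (fun b : U' => (b : Excitation K p))).rank := by
  classical
  have h : ∀ v : {v // c v ≠ .inl v}, (v : Fin L) ∈ Y' ∧ ∃ u ∈ U', c v = .inr u :=
    fun v => (hc.cases v).resolve_left v.2
  choose hY u hU hu using h
  rw [det_link hA U u hu] at hdet
  have h1 : IsUnit ((A⁻¹ * U).submatrix (Subtype.val : {v // c v ≠ .inl v} → Fin L) u) := by
    rw [Matrix.isUnit_iff_isUnit_det]
    exact (right_ne_zero_of_mul hdet).isUnit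
  have h2 := Matrix.rank_of_isUnit _ h1
  rw [ModelSet.linkCard, ← Fintype.card_subtype, ← h2]
  exact Matrix.rank_submatrix_le ((A⁻¹ * U).submatrix (fun a : Y' => (a : Fin L))
      (fun b : U' => (b : Excitation K p))) (fun v : {v // c v ≠ .inl v} => ⟨v, hY v⟩)
    (fun v => ⟨u v, hU v⟩)

/-- A nonzero minor of maximal size exhibits a nonsingular exchange of columns. -/
theorem exists_link_of_rank (U' : Finset (Excitation K p)) (Y' : Finset (Fin L))
    {A : Matrix (Fin L) (Fin L) F} (hA : A.det ≠ 0)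
    (U : Matrix (Fin L) (Excitation K p) F) :
    ∃ c : Fin L → Signal L K p, ModelSet.IsLink U' Y' c ∧
      ModelSet.linkCard c = ((A⁻¹ * U).submatrix (fun a : Y' => (a : Fin L))
        (fun b : U' => (b : Excitation K p))).rank ∧
      ((Matrix.fromCols A U).submatrix id c).det ≠ 0 := by
  classical
  obtain ⟨n, hn, r, s, hdet⟩ : ∃ n, n = ((A⁻¹ * U).submatrix
      (fun a : Y' => (a : Fin L)) (fun b : U' => (b : Excitation K p))).rank ∧
      ∃ (r : Fin n ↪ Y') (s : Fin n ↪ U'), ((A⁻¹ * U).submatrix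
        (fun i => (r i : Fin L)) (fun i => (s i : Excitation K p))).det ≠ 0 :=
    ⟨_, rfl, exists_submatrix_det_ne_zero _⟩
  let r' : Fin n → Fin L := fun i => r i
  have hr' : Function.Injective r' := fun i j h => r.injective (Subtype.ext h)
  let c : Fin L → Signal L K p := fun v =>
    if h : ∃ i, r' i = v then .inr (s h.choose) else .inl v
  have hc₁ : ∀ i, c (r' i) = .inr (s i) := fun i => by
    have h : ∃ j, r' j = r' i := ⟨i, rfl⟩
    simp only [c]
    rw [dif_pos h, hr' h.choose_spec]
  have hc₂ : ∀ v, (¬ ∃ i, r' i = v) → c v = .inl v := fun v h => by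
    simp only [c]
    rw [dif_neg h]
  have hcne : ∀ v, c v ≠ .inl v ↔ ∃ i, r' i = v := fun v => by
    constructor
    · intro h
      by_contra h'
      exact h (hc₂ v h')
    · rintro ⟨i, rfl⟩
      rw [hc₁]; simp
  have hc : ModelSet.IsLink U' Y' c := by
    refine ⟨fun v w hvw => ?_, fun v => ?_⟩
    · by_cases hv : ∃ i, r' i = v <;> by_cases hw : ∃ j, r' j = w
      · obtain ⟨i, rfl⟩ := hv
        obtain ⟨j, rfl⟩ := hw
        rw [hc₁, hc₁, Sum.inr.injEq] at hvw
        rw [s.injective (Subtype.ext hvw)]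
      · obtain ⟨i, rfl⟩ := hv
        rw [hc₁, hc₂ w hw] at hvw
        simp at hvw
      · obtain ⟨j, rfl⟩ := hw
        rw [hc₁, hc₂ v hv] at hvw
        simp at hvw
      · rw [hc₂ v hv, hc₂ w hw] at hvw
        exact Sum.inl.inj hvw
    · by_cases hv : ∃ i, r' i = v
      · obtain ⟨i, rfl⟩ := hv
        exact Or.inr ⟨(r i).2, _, (s i).2, hc₁ i⟩
      · exact Or.inl (hc₂ v hv)
  let e : Fin n ≃ {v // c v ≠ .inl v} := Equiv.ofBijective
    (fun i => ⟨r' i, (hcne _).2 ⟨i, rfl⟩⟩)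
    ⟨fun i j h => hr' (congrArg Subtype.val h :), fun v => by
      obtain ⟨i, hi⟩ := (hcne v).1 v.2
      exact ⟨i, Subtype.ext hi⟩⟩
  refine ⟨c, hc, ?_, ?_⟩
  · rw [ModelSet.linkCard, ← Fintype.card_subtype, ← Fintype.card_congr e, Fintype.card_fin, hn]
  · rw [det_link hA U (fun v => s (e.symm v)) (fun v => by
      obtain ⟨i, rfl⟩ := e.surjective v
      rw [Equiv.symm_apply_apply]
      exact hc₁ i)]
    refine mul_ne_zero hA ?_
    rw [← Matrix.det_submatrix_equiv_self e]
    convert hdet using 2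
    ext i j
    simp only [Matrix.submatrix_apply, Equiv.symm_apply_apply]
    rfl

end

namespace ModelSet

variable {L K p : ℕ} {S : ModelSet L K p}

theorem HasDisjointPaths.mono {U' : Finset (Excitation K p)} {Y' : Finset (Fin L)} {m n : ℕ}
    (h : S.HasDisjointPaths U' Y' n) (hmn : m ≤ n) : S.HasDisjointPaths U' Y' m := by
  obtain ⟨P, hP, hd⟩ := h
  exact ⟨fun a => P (Fin.castLE hmn a), fun a => hP _, fun a b hab =>
    hd _ _ fun h => hab ((Fin.castLE_injective hmn) h)⟩

theorem hasEdge_of_entry_ne_zero {M : NetworkModel L K p} (hM : M ∈ S.models) {j : Fin L}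
    {s : Signal L K p} (h : M.entry j s ≠ 0) : S.HasEdge j s := by
  by_cases hs : s ∈ S.par j
  · exact Or.inl hs
  · exact Or.inr (hM.2.1 j s hs ▸ h)

/-- In every model the rank of a submatrix of `T` is at most the number of disjoint paths: a nonzero
minor has a nonzero transversal. -/
theorem hasDisjointPaths_rank {M : NetworkModel L K p} (hM : M ∈ S.models) (j : Fin L)
    (Y' : Finset (Fin L)) : S.HasDisjointPaths (S.UU j) Y' (S.subT j Y' M).rank := by
  obtain ⟨c, hc, hcard, hdet⟩ := exists_link_of_rank (S.UU j) Y' hM.1.det_ne_zero M.U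
  have hrank : linkCard c = (S.subT j Y' M).rank := hcard
  rw [← hrank]
  rw [Matrix.det_apply] at hdet
  obtain ⟨σ, -, hσ⟩ := Finset.exists_ne_zero_of_sum_ne_zero hdet
  refine hasDisjointPaths_of_isTransversal hc (σ := σ) fun v => ?_
  have h1 : ∏ v, Matrix.fromCols (1 - M.G) M.U (σ v) (c v) ≠ 0 := by
    intro h
    apply hσ
    rw [show (∏ i, (Matrix.fromCols (1 - M.G) M.U).submatrix id c (σ i) i) = 0 from h, smul_zero]
  have h2 := Finset.prod_ne_zero_iff.1 h1 v (Finset.mem_univ _)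
  rcases hcv : c v with w | u
  · by_cases hw : w = σ v
    · left; rw [hw]
    · right
      rw [hcv, Matrix.fromCols_apply_inl, Matrix.sub_apply, Matrix.one_apply_ne (Ne.symm hw),
        zero_sub, neg_ne_zero] at h2
      exact hasEdge_of_entry_ne_zero hM h2
  · right
    rw [hcv] at h2
    exact hasEdge_of_entry_ne_zero hM h2

end ModelSet

/-! ### Proper and stable functions as fractions in `z⁻¹` -/

/-- The fractions with numerator in the image of `φ : A → B` and denominator in the image of `Q`.
The denominators need not be units of `B`. -/
def fracSubring {A B : Type*} [CommRing A] [CommRing B] (φ : A →+* B) (Q : Submonoid A) :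
    Subring B where
  carrier := {b | ∃ a, ∃ q ∈ Q, b * φ q = φ a}
  mul_mem' := by
    rintro b b' ⟨a, q, hq, h⟩ ⟨a', q', hq', h'⟩
    exact ⟨a * a', q * q', Q.mul_mem hq hq', by rw [map_mul, map_mul, ← h, ← h']; ring⟩
  one_mem' := ⟨1, 1, Q.one_mem, by simp⟩
  add_mem' := by
    rintro b b' ⟨a, q, hq, h⟩ ⟨a', q', hq', h'⟩
    exact ⟨a * q' + a' * q, q * q', Q.mul_mem hq hq', by
      rw [map_mul, map_add, map_mul, map_mul, ← h, ← h']; ring⟩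
  zero_mem' := ⟨0, 1, Q.one_mem, by simp⟩
  neg_mem' := by
    rintro b ⟨a, q, hq, h⟩
    exact ⟨-a, q, hq, by rw [map_neg, ← h, neg_mul]⟩

theorem fracSubring_mono {A B : Type*} [CommRing A] [CommRing B] {φ : A →+* B}
    {Q Q' : Submonoid A} (h : Q ≤ Q') : fracSubring φ Q ≤ fracSubring φ Q' := by
  rintro b ⟨a, q, hq, h'⟩
  exact ⟨a, q, h hq, h'⟩

theorem map_mem_fracSubring {A B : Type*} [CommRing A] [CommRing B] (φ : A →+* B)
    (Q : Submonoid A) (a : A) : φ a ∈ fracSubring φ Q :=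
  ⟨a, 1, Q.one_mem, by simp⟩

/-- The substitution `q ↦ q(z⁻¹)`. In the variable `z⁻¹`, the point `z = ∞` is the origin, and the
exterior of the open unit disc together with `∞` is the closed unit disc. -/
noncomputable def invSubst : ℝ[X] →+* RatFunc ℝ :=
  (Polynomial.aeval (RatFunc.X : RatFunc ℝ)⁻¹).toRingHom

theorem invSubst_X : invSubst Polynomial.X = (RatFunc.X : RatFunc ℝ)⁻¹ := by
  simp [invSubst]

theorem invSubst_C (r : ℝ) : invSubst (Polynomial.C r) = RatFunc.C r := by
  simp [invSubst, RatFunc.algebraMap_eq_C]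

theorem X_pow_mul_invSubst (N : ℕ) (q : ℝ[X]) (hq : q.natDegree ≤ N) :
    RatFunc.X ^ N * invSubst q = algebraMap ℝ[X] (RatFunc ℝ) (q.reflect N) := by
  let : Invertible (RatFunc.X : RatFunc ℝ) := invertibleOfNonzero RatFunc.X_ne_zero
  have h := Polynomial.eval₂_reflect_mul_pow (algebraMap ℝ (RatFunc ℝ)) RatFunc.X N (q.reflect N)
    (Polynomial.natDegree_reflect_le.trans (by simp [hq]))
  rw [Polynomial.reflect_reflect, invOf_eq_inv] at h
  rw [mul_comm]
  refine h.trans ?_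
  rw [← Polynomial.aeval_def, RatFunc.aeval_X_left_eq_algebraMap]

theorem invSubst_injective : Function.Injective invSubst := by
  rw [injective_iff_map_eq_zero]
  intro q hq
  have h := X_pow_mul_invSubst q.natDegree q le_rfl
  rw [hq, mul_zero] at h
  have h2 := (map_eq_zero_iff _ (RatFunc.algebraMap_injective ℝ)).1 h.symm
  exact Polynomial.reflect_eq_zero_iff.1 h2

/-- A fraction in `z⁻¹` as a fraction in `z`: numerator and denominator are reflected in a common
degree bound. -/
theorem num_mul_reflect {f : RatFunc ℝ} {a q : ℝ[X]} (h : f * invSubst q = invSubst a) {N : ℕ}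
    (ha : a.natDegree ≤ N) (hq : q.natDegree ≤ N) :
    f.num * q.reflect N = a.reflect N * f.denom := by
  apply RatFunc.algebraMap_injective ℝ
  have hd : algebraMap ℝ[X] (RatFunc ℝ) f.denom ≠ 0 :=
    (map_ne_zero_iff _ (RatFunc.algebraMap_injective ℝ)).2 f.denom_ne_zero
  rw [map_mul, map_mul, ← X_pow_mul_invSubst N q hq, ← X_pow_mul_invSubst N a ha, ← h]
  have hf := RatFunc.num_div_denom f
  rw [div_eq_iff hd] at hf
  rw [hf]
  ring

theorem div_mul_invSubst_reflect {n d : ℝ[X]} (hd : d ≠ 0) {N : ℕ} (hn : n.natDegree ≤ N)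
    (hdN : d.natDegree ≤ N) :
    algebraMap ℝ[X] (RatFunc ℝ) n / algebraMap ℝ[X] (RatFunc ℝ) d * invSubst (d.reflect N) =
      invSubst (n.reflect N) := by
  have hd' : algebraMap ℝ[X] (RatFunc ℝ) d ≠ 0 :=
    (map_ne_zero_iff _ (RatFunc.algebraMap_injective ℝ)).2 hd
  have h : ∀ m : ℝ[X], m.natDegree ≤ N →
      RatFunc.X ^ N * invSubst (m.reflect N) = algebraMap ℝ[X] (RatFunc ℝ) m := fun m hm => by
    rw [X_pow_mul_invSubst N _ (Polynomial.natDegree_reflect_le.trans (by simp [hm])),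
      Polynomial.reflect_reflect]
  have hX : (RatFunc.X : RatFunc ℝ) ^ N ≠ 0 := pow_ne_zero _ RatFunc.X_ne_zero
  apply mul_left_cancel₀ hX
  rw [mul_left_comm, h d hdN, h n hn, div_mul_cancel₀ _ hd']

/-- The polynomials that do not vanish at the origin. -/
def nonvanishingAtZero : Submonoid ℝ[X] where
  carrier := {q | q.coeff 0 ≠ 0}
  mul_mem' := by
    intro q q' h h'
    simpa [Polynomial.mul_coeff_zero] using And.intro h h'
  one_mem' := by simp

/-- The polynomials without zeros in the closed unit disc. -/
def nonvanishingOnDisc : Submonoid ℝ[X] where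
  carrier := {q | ∀ w : ℂ, ‖w‖ ≤ 1 → Polynomial.aeval w q ≠ 0}
  mul_mem' := by
    intro q q' h h' w hw
    rw [map_mul]
    exact mul_ne_zero (h w hw) (h' w hw)
  one_mem' := by simp

theorem nonvanishingOnDisc_le : nonvanishingOnDisc ≤ nonvanishingAtZero := by
  intro q hq h
  refine hq 0 (by simp) ?_
  rw [← Polynomial.coeff_zero_eq_aeval_zero', h, map_zero]

/-- The proper transfer functions. -/
noncomputable def properRing : Subring (RatFunc ℝ) := fracSubring invSubst nonvanishingAtZero

/-- The proper stable transfer functions. -/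
noncomputable def stableRing : Subring (RatFunc ℝ) := fracSubring invSubst nonvanishingOnDisc

theorem stableRing_le_properRing : stableRing ≤ properRing :=
  fracSubring_mono nonvanishingOnDisc_le

/-- The degree of the reflected denominator is exactly `N`, because the constant coefficient of `q`
is nonzero. -/
theorem isProper_of_mul_eq {f : RatFunc ℝ} {a q : ℝ[X]} (hq : q.coeff 0 ≠ 0)
    (h : f * invSubst q = invSubst a) : IsProper f := by
  set N := max a.natDegree q.natDegree
  have key := num_mul_reflect h (N := N) (le_max_left _ _) (le_max_right _ _)
  have hqN : (q.reflect N).degree = N := by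
    refine le_antisymm ?_ ?_
    · refine Polynomial.degree_le_of_natDegree_le (Polynomial.natDegree_reflect_le.trans ?_)
      simp [N]
    · exact Polynomial.le_degree_of_ne_zero (by simpa [Polynomial.coeff_reflect] using hq)
  have haN : (a.reflect N).degree ≤ N := by
    refine Polynomial.degree_le_of_natDegree_le (Polynomial.natDegree_reflect_le.trans ?_)
    simp [N]
  have hdeg := congrArg Polynomial.degree key
  rw [Polynomial.degree_mul, Polynomial.degree_mul, hqN] at hdeg
  have h1 : f.num.degree + N ≤ f.denom.degree + N := by
    rw [hdeg, add_comm]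
    gcongr
  exact (WithBot.add_le_add_iff_right (by simp)).1 h1

theorem isProper_iff {f : RatFunc ℝ} : IsProper f ↔ f ∈ properRing := by
  constructor
  · intro h
    have h1 : f.num.natDegree ≤ f.denom.natDegree := Polynomial.natDegree_le_natDegree h
    refine ⟨f.num.reflect f.denom.natDegree, f.denom.reflect f.denom.natDegree, ?_, ?_⟩
    · change (f.denom.reflect f.denom.natDegree).coeff 0 ≠ 0
      rw [Polynomial.coeff_reflect, Polynomial.revAt_zero]
      simp [RatFunc.denom_ne_zero]
    · have := div_mul_invSubst_reflect f.denom_ne_zero h1 le_rfl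
      rwa [RatFunc.num_div_denom] at this
  · rintro ⟨a, q, hq, h⟩
    exact isProper_of_mul_eq hq h

theorem valueAtInfinity_eq {f : RatFunc ℝ} {a q : ℝ[X]} (hq : q.coeff 0 ≠ 0)
    (h : f * invSubst q = invSubst a) : valueAtInfinity f = a.coeff 0 / q.coeff 0 := by
  set N := max a.natDegree q.natDegree
  have key := num_mul_reflect h (N := N) (le_max_left _ _) (le_max_right _ _)
  have hN : ∀ m : ℝ[X], m.natDegree ≤ N → (m.reflect N).natDegree ≤ N := fun m hm =>
    Polynomial.natDegree_reflect_le.trans (by simp [hm])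
  have h1 := congrArg (fun m => Polynomial.coeff m (f.denom.natDegree + N)) key
  rw [Polynomial.coeff_mul_add_eq_of_natDegree_le
      (Polynomial.natDegree_le_natDegree (isProper_of_mul_eq hq h)) (hN q (le_max_right _ _)),
    add_comm, Polynomial.coeff_mul_add_eq_of_natDegree_le (hN a (le_max_left _ _)) le_rfl,
    Polynomial.coeff_reflect, Polynomial.coeff_reflect] at h1
  simp only [Polynomial.coeff_natDegree, f.monic_denom.leadingCoeff, mul_one,
    Polynomial.revAt_le le_rfl, Nat.sub_self] at h1
  rw [eq_div_iff hq, ← h1, valueAtInfinity]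

theorem isStrictlyProper_iff_valueAtInfinity {f : RatFunc ℝ} :
    IsStrictlyProper f ↔ IsProper f ∧ valueAtInfinity f = 0 := by
  constructor
  · intro h
    refine ⟨le_of_lt h, ?_⟩
    exact Polynomial.coeff_eq_zero_of_degree_lt
      (h.trans_eq (Polynomial.degree_eq_natDegree f.denom_ne_zero))
  · rintro ⟨h, h0⟩
    rw [IsStrictlyProper, Polynomial.degree_eq_natDegree f.denom_ne_zero,
      Polynomial.degree_lt_iff_coeff_zero]
    intro m hm
    rcases hm.eq_or_lt with rfl | hm
    · exact h0
    · exact Polynomial.coeff_eq_zero_of_natDegree_lt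
        ((Polynomial.natDegree_le_natDegree h).trans_lt hm)

/-- A zero at `z = ∞` can be divided out: its factor is `z⁻¹`. -/
theorem isStrictlyProper_iff {f : RatFunc ℝ} : IsStrictlyProper f ↔ RatFunc.X * f ∈ properRing := by
  rw [isStrictlyProper_iff_valueAtInfinity]
  constructor
  · rintro ⟨h, h0⟩
    obtain ⟨a, q, hq, haq⟩ := isProper_iff.1 h
    rw [valueAtInfinity_eq hq haq, div_eq_zero_iff, or_iff_left hq] at h0
    obtain ⟨b, rfl⟩ := Polynomial.X_dvd_iff.2 h0
    refine ⟨b, q, hq, ?_⟩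
    rw [map_mul, invSubst_X] at haq
    rw [mul_assoc, haq, mul_inv_cancel_left₀ RatFunc.X_ne_zero]
  · rintro ⟨b, q, hq, hbq⟩
    have h : f * invSubst q = invSubst (Polynomial.X * b) := by
      rw [map_mul, ← hbq, invSubst_X, mul_assoc, inv_mul_cancel_left₀ RatFunc.X_ne_zero]
    refine ⟨isProper_of_mul_eq hq h, ?_⟩
    rw [valueAtInfinity_eq hq h]
    simp

theorem IsStrictlyProper.isProper {f : RatFunc ℝ} (h : IsStrictlyProper f) : IsProper f :=
  le_of_lt h

theorem valueAtInfinity_add {f g : RatFunc ℝ} (hf : IsProper f) (hg : IsProper g) :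
    valueAtInfinity (f + g) = valueAtInfinity f + valueAtInfinity g := by
  obtain ⟨a, q, hq, haq⟩ := isProper_iff.1 hf
  obtain ⟨b, r, hr, hbr⟩ := isProper_iff.1 hg
  have h : (f + g) * invSubst (q * r) = invSubst (a * r + b * q) := by
    rw [map_mul, map_add, map_mul, map_mul, ← haq, ← hbr]; ring
  rw [valueAtInfinity_eq (nonvanishingAtZero.mul_mem hq hr) h, valueAtInfinity_eq hq haq,
    valueAtInfinity_eq hr hbr]
  have hq' : q.coeff 0 ≠ 0 := hq
  have hr' : r.coeff 0 ≠ 0 := hr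
  simp only [Polynomial.mul_coeff_zero, Polynomial.coeff_add]
  field_simp

theorem valueAtInfinity_add_of_isStrictlyProper {f g : RatFunc ℝ} (hf : IsProper f)
    (hg : IsStrictlyProper g) : valueAtInfinity (f + g) = valueAtInfinity f := by
  rw [valueAtInfinity_add hf hg.isProper, (isStrictlyProper_iff_valueAtInfinity.1 hg).2, add_zero]

theorem aeval_reflect {N : ℕ} {q : ℝ[X]} (hq : q.natDegree ≤ N) {z : ℂ} (hz : z ≠ 0) :
    Polynomial.aeval z⁻¹ (q.reflect N) * z ^ N = Polynomial.aeval z q := by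
  let : Invertible z := invertibleOfNonzero hz
  have h := Polynomial.eval₂_reflect_mul_pow (algebraMap ℝ ℂ) z N q hq
  rwa [invOf_eq_inv] at h

theorem reflect_denom_mem {f : RatFunc ℝ} (hs : IsStable f) :
    f.denom.reflect f.denom.natDegree ∈ nonvanishingOnDisc := by
  intro w hw h0
  rcases eq_or_ne w 0 with rfl | hw0
  · rw [← Polynomial.coeff_zero_eq_aeval_zero', Polynomial.coeff_reflect,
      Polynomial.revAt_zero] at h0
    simp [RatFunc.denom_ne_zero] at h0
  · have h2 := aeval_reflect (le_refl f.denom.natDegree) (inv_ne_zero hw0)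
    rw [inv_inv, h0, zero_mul] at h2
    have h3 := hs _ h2.symm
    rw [norm_inv] at h3
    have := (one_le_inv₀ (norm_pos_iff.2 hw0)).2 hw
    linarith

/-- Properness excludes a pole at `∞`, stability excludes poles with `1 ≤ ‖z‖`: together these are
the points of the closed unit disc in the variable `z⁻¹`. -/
theorem isProper_and_isStable_iff {f : RatFunc ℝ} :
    IsProper f ∧ IsStable f ↔ f ∈ stableRing := by
  constructor
  · rintro ⟨h, hs⟩
    have h1 : f.num.natDegree ≤ f.denom.natDegree := Polynomial.natDegree_le_natDegree h
    refine ⟨f.num.reflect f.denom.natDegree, f.denom.reflect f.denom.natDegree, ?_, ?_⟩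
    · exact reflect_denom_mem hs
    · have := div_mul_invSubst_reflect f.denom_ne_zero h1 le_rfl
      rwa [RatFunc.num_div_denom] at this
  · intro hf
    refine ⟨isProper_iff.2 (stableRing_le_properRing hf), ?_⟩
    obtain ⟨a, q, hq, h⟩ := hf
    intro z hz
    by_contra hz1
    push Not at hz1
    have hz0 : z ≠ 0 := by
      rintro rfl
      norm_num at hz1
    set N := max a.natDegree q.natDegree
    have key := num_mul_reflect h (N := N) (le_max_left _ _) (le_max_right _ _)
    have hdvd : f.denom ∣ q.reflect N :=
      (RatFunc.isCoprime_num_denom f).symm.dvd_of_dvd_mul_left ⟨_, key.trans (mul_comm _ _)⟩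
    obtain ⟨b, hb⟩ := hdvd
    have h2 : Polynomial.aeval z (q.reflect N) = 0 := by rw [hb, map_mul, hz, zero_mul]
    have h3 := aeval_reflect (N := N) (q := q.reflect N)
      (Polynomial.natDegree_reflect_le.trans (by simp [N])) hz0
    rw [Polynomial.reflect_reflect, h2] at h3
    refine hq z⁻¹ ?_ ((mul_eq_zero.1 h3).resolve_right (pow_ne_zero _ hz0))
    rw [norm_inv]
    exact inv_le_one_of_one_le₀ hz1

/-! ### Families of transfer functions with polynomial parameter dependence -/

open MeasureTheory in
/-- By Fubini: for almost all values of the other variables, the leading coefficient in the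
first variable does not vanish, so that only finitely many values of that variable are zeros. -/
theorem ae_eval_ne_zero_fin (n : ℕ) (q : MvPolynomial (Fin n) ℝ) (hq : q ≠ 0) :
    ∀ᵐ x : Fin n → ℝ, MvPolynomial.eval x q ≠ 0 := by
  induction n with
  | zero =>
    refine Filter.Eventually.of_forall fun x h => hq ?_
    apply MvPolynomial.funext
    intro y
    rw [Subsingleton.elim y x, h, map_zero]
  | succ n ih =>
    set r := MvPolynomial.finSuccEquiv ℝ n q with hr
    have hr0 : r ≠ 0 := by simpa [hr] using hq
    have h1 : ∀ᵐ x : Fin n → ℝ, r.map (MvPolynomial.eval x) ≠ 0 := by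
      have hlc : r.leadingCoeff ≠ 0 := Polynomial.leadingCoeff_ne_zero.2 hr0
      filter_upwards [ih _ hlc] with x hx h
      apply hx
      have := congrArg (fun m => Polynomial.coeff m r.natDegree) h
      simpa [Polynomial.coeff_map] using this
    have hmeas : MeasurableSet {z : (Fin n → ℝ) × ℝ |
        MvPolynomial.eval (Fin.cons z.2 z.1 : Fin (n + 1) → ℝ) q = 0} := by
      have hc : Continuous fun z : (Fin n → ℝ) × ℝ => (Fin.cons z.2 z.1 : Fin (n + 1) → ℝ) := by
        refine continuous_pi fun i => ?_
        refine Fin.cases ?_ (fun i => ?_) i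
        · simpa using continuous_snd
        · simp only [Fin.cons_succ]
          fun_prop
      exact (isClosed_singleton (x := (0 : ℝ)).preimage
        ((MvPolynomial.continuous_eval q).comp hc)).measurableSet
    have h2 : ∀ᵐ z : (Fin n → ℝ) × ℝ,
        MvPolynomial.eval (Fin.cons z.2 z.1 : Fin (n + 1) → ℝ) q ≠ 0 := by
      rw [ae_iff]
      simp only [not_not]
      rw [Measure.volume_eq_prod, Measure.measure_prod_null hmeas]
      filter_upwards [h1] with x hx
      have hsub : Prod.mk x ⁻¹' {z : (Fin n → ℝ) × ℝ |
          MvPolynomial.eval (Fin.cons z.2 z.1 : Fin (n + 1) → ℝ) q = 0} ⊆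
          ((r.map (MvPolynomial.eval x)).roots.toFinset : Set ℝ) := by
        intro t ht
        simp only [Set.mem_preimage, Set.mem_ofPred_eq,
          MvPolynomial.eval_eq_eval_mv_eval'] at ht
        simpa [hx] using ht
      exact measure_mono_null hsub ((Finset.finite_toSet _).measure_zero _)
    have hmp := volume_preserving_piFinSuccAbove (fun _ : Fin (n + 1) => ℝ) 0
    have h3 : ∀ᵐ z : ℝ × (Fin n → ℝ),
        MvPolynomial.eval (Fin.cons z.1 z.2 : Fin (n + 1) → ℝ) q ≠ 0 :=
      (Measure.measurePreserving_swap (μ := (volume : Measure ℝ))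
        (ν := (volume : Measure (Fin n → ℝ)))).quasiMeasurePreserving.ae h2
    filter_upwards [hmp.quasiMeasurePreserving.ae h3] with x hx
    convert hx using 3
    ext i
    refine Fin.cases ?_ (fun i => ?_) i <;> simp [MeasurableEquiv.piFinSuccAbove, Fin.tail]

open MeasureTheory in
/-- The zero set of a nonzero polynomial is a Lebesgue null set. -/
theorem ae_eval_ne_zero {ι : Type*} [Fintype ι] (q : MvPolynomial ι ℝ) (hq : q ≠ 0) :
    ∀ᵐ x : ι → ℝ, MvPolynomial.eval x q ≠ 0 := by
  let e := Fintype.equivFin ι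
  have h := ae_eval_ne_zero_fin (Fintype.card ι) (MvPolynomial.rename e q)
    ((map_ne_zero_iff _ (MvPolynomial.rename_injective e e.injective)).2 hq)
  have hmp := volume_measurePreserving_piCongrLeft (fun _ : Fin (Fintype.card ι) => ℝ) e
  filter_upwards [hmp.quasiMeasurePreserving.ae h] with x hx
  rw [MvPolynomial.eval_rename] at hx
  convert hx using 3
  ext i
  simp [MeasurableEquiv.piCongrLeft]

theorem det_mem {B n : Type*} [CommRing B] [Fintype n] [DecidableEq n] (R : Subring B)
    {A : Matrix n n B} (hA : ∀ i j, A i j ∈ R) : A.det ∈ R := by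
  rw [Matrix.det_apply]
  refine R.sum_mem fun σ _ => ?_
  rw [Units.smul_def]
  exact R.zsmul_mem (R.prod_mem fun i _ => hA _ _) _

theorem adjugate_mem {B n : Type*} [CommRing B] [Fintype n] [DecidableEq n] (R : Subring B)
    {A : Matrix n n B} (hA : ∀ i j, A i j ∈ R) (i j : n) : A.adjugate i j ∈ R := by
  rw [Matrix.adjugate_apply]
  refine det_mem R fun k l => ?_
  rw [Matrix.updateRow_apply]
  split_ifs
  · rw [Pi.single_apply]
    split_ifs
    exacts [R.one_mem, R.zero_mem]
  · exact hA k l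

theorem mul_apply_mem {B l m n : Type*} [CommRing B] [Fintype m] (R : Subring B)
    {A : Matrix l m B} {C : Matrix m n B} (hA : ∀ i j, A i j ∈ R) (hC : ∀ i j, C i j ∈ R)
    (i : l) (j : n) : (A * C) i j ∈ R := by
  rw [Matrix.mul_apply]
  exact R.sum_mem fun k _ => R.mul_mem (hA _ _) (hC _ _)

theorem one_sub_mem {B n : Type*} [CommRing B] [DecidableEq n] (R : Subring B)
    {A : Matrix n n B} (hA : ∀ i j, A i j ∈ R) (i j : n) : (1 - A) i j ∈ R := by
  rw [Matrix.sub_apply, Matrix.one_apply]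
  refine R.sub_mem ?_ (hA _ _)
  split_ifs
  exacts [R.one_mem, R.zero_mem]

theorem det_family_mem {Θ F n : Type*} [CommRing F] [Fintype n] [DecidableEq n]
    (R : Subring (Θ → F)) {A : Θ → Matrix n n F} (hA : ∀ i j, (fun θ => A θ i j) ∈ R) :
    (fun θ => (A θ).det) ∈ R := by
  have h := det_mem R (A := Matrix.of fun i j θ => A θ i j) hA
  convert h using 1
  ext θ
  exact ((Pi.evalRingHom (fun _ : Θ => F) θ).map_det (Matrix.of fun i j θ => A θ i j)).symm

variable {ι : Type*}

/-- The family `θ ↦ q_θ(z⁻¹)`, where `q_θ` is obtained by evaluation of the coefficients of `q`,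
which are polynomials in the parameters. -/
noncomputable def family (ι : Type*) : (MvPolynomial ι ℝ)[X] →+* ((ι → ℝ) → RatFunc ℝ) :=
  RingHom.pi fun θ => invSubst.comp (Polynomial.mapRingHom (MvPolynomial.eval θ))

theorem family_apply (q : (MvPolynomial ι ℝ)[X]) (θ : ι → ℝ) :
    family ι q θ = invSubst (q.map (MvPolynomial.eval θ)) := rfl

/-- The families of fractions whose denominators do not vanish at `θ₀`. -/
noncomputable def ratFamilies (θ₀ : ι → ℝ) : Subring ((ι → ℝ) → RatFunc ℝ) :=
  fracSubring (family ι)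
    ((nonZeroDivisors ℝ[X]).comap (Polynomial.mapRingHom (MvPolynomial.eval θ₀)))

/-- The families of fractions whose denominators at `θ₀` do not vanish on the closed unit disc. -/
noncomputable def stableFamilies (θ₀ : ι → ℝ) : Subring ((ι → ℝ) → RatFunc ℝ) :=
  fracSubring (family ι)
    (nonvanishingOnDisc.comap (Polynomial.mapRingHom (MvPolynomial.eval θ₀)))

theorem const_mem_stableFamilies {f : RatFunc ℝ} (hf : f ∈ stableRing) (θ₀ : ι → ℝ) :
    (fun _ => f) ∈ stableFamilies θ₀ := by
  obtain ⟨a, q, hq, h⟩ := hf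
  have hmap : ∀ (b : ℝ[X]) (θ : ι → ℝ),
      (b.map MvPolynomial.C).map (MvPolynomial.eval θ) = b := fun b θ => by
    rw [Polynomial.map_map]
    convert Polynomial.map_id
    ext; simp
  refine ⟨a.map MvPolynomial.C, q.map MvPolynomial.C, ?_, ?_⟩
  · change (q.map MvPolynomial.C).map (MvPolynomial.eval θ₀) ∈ nonvanishingOnDisc
    rwa [hmap]
  · ext1 θ
    rw [Pi.mul_apply, family_apply, family_apply, hmap, hmap, h]

theorem const_mem_ratFamilies (f : RatFunc ℝ) (θ₀ : ι → ℝ) :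
    (fun _ => f) ∈ ratFamilies θ₀ := by
  set N := max f.num.natDegree f.denom.natDegree
  have h := div_mul_invSubst_reflect f.denom_ne_zero (N := N) (le_max_left _ _) (le_max_right _ _)
  rw [RatFunc.num_div_denom] at h
  have hmap : ∀ (b : ℝ[X]) (θ : ι → ℝ),
      (b.map MvPolynomial.C).map (MvPolynomial.eval θ) = b := fun b θ => by
    rw [Polynomial.map_map]
    convert Polynomial.map_id
    ext; simp
  refine ⟨(f.num.reflect N).map MvPolynomial.C, (f.denom.reflect N).map MvPolynomial.C, ?_, ?_⟩
  · change ((f.denom.reflect N).map MvPolynomial.C).map (MvPolynomial.eval θ₀) ∈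
      nonZeroDivisors ℝ[X]
    rw [hmap, mem_nonZeroDivisors_iff_ne_zero, Ne, Polynomial.reflect_eq_zero_iff]
    exact f.denom_ne_zero
  · ext1 θ
    rw [Pi.mul_apply, family_apply, family_apply, hmap, hmap, h]

theorem continuous_aeval_map (q : (MvPolynomial ι ℝ)[X]) :
    Continuous fun x : (ι → ℝ) × ℂ =>
      Polynomial.aeval x.2 (q.map (MvPolynomial.eval x.1)) := by
  have h : ∀ x : (ι → ℝ) × ℂ, Polynomial.aeval x.2 (q.map (MvPolynomial.eval x.1)) =
      ∑ i ∈ Finset.range (q.natDegree + 1),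
        ((MvPolynomial.eval x.1 (q.coeff i) : ℝ) : ℂ) * x.2 ^ i := fun x => by
    rw [Polynomial.aeval_eq_sum_range' (n := q.natDegree + 1)
      (Nat.lt_succ_of_le Polynomial.natDegree_map_le)]
    simp [Polynomial.coeff_map]
  simp_rw [h]
  refine continuous_finsetSum _ fun i _ => ?_
  exact (Complex.continuous_ofReal.comp
    ((MvPolynomial.continuous_eval _).comp continuous_fst)).mul (continuous_snd.pow i)

/-- Having no zeros in the closed unit disc is an open condition, because the disc is compact. -/
theorem eventually_nonvanishingOnDisc {q : (MvPolynomial ι ℝ)[X]} {θ₀ : ι → ℝ}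
    (hq : q.map (MvPolynomial.eval θ₀) ∈ nonvanishingOnDisc) :
    ∀ᶠ θ in nhds θ₀, q.map (MvPolynomial.eval θ) ∈ nonvanishingOnDisc := by
  have h := (isCompact_closedBall (0 : ℂ) 1).eventually_forall_of_forall_eventually (x₀ := θ₀)
    (P := fun θ w => Polynomial.aeval w (q.map (MvPolynomial.eval θ)) ≠ 0) (by
      intro w hw
      exact (continuous_aeval_map q).continuousAt.eventually_ne
        (hq w (by simpa using hw)))
  filter_upwards [h] with θ hθ w hw
  exact hθ w (by simpa using hw)

theorem eventually_mem_stableRing {f : (ι → ℝ) → RatFunc ℝ} {θ₀ : ι → ℝ}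
    (hf : f ∈ stableFamilies θ₀) : ∀ᶠ θ in nhds θ₀, f θ ∈ stableRing := by
  obtain ⟨a, q, hq, h⟩ := hf
  filter_upwards [eventually_nonvanishingOnDisc hq] with θ hθ
  exact ⟨_, _, hθ, congrFun h θ⟩

/-- The units among the proper stable functions are an open set in a family. -/
theorem eventually_inv_mem_stableRing {f : (ι → ℝ) → RatFunc ℝ} {θ₀ : ι → ℝ}
    (hf : f ∈ stableFamilies θ₀) (h0 : f θ₀ ≠ 0) (hinv : (f θ₀)⁻¹ ∈ stableRing) :
    ∀ᶠ θ in nhds θ₀, f θ ≠ 0 ∧ (f θ)⁻¹ ∈ stableRing := by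
  obtain ⟨a, q, hq, h⟩ := hf
  have hqθ : q.map (MvPolynomial.eval θ₀) ∈ nonvanishingOnDisc := hq
  have haq : f θ₀ * invSubst (q.map (MvPolynomial.eval θ₀)) =
    invSubst (a.map (MvPolynomial.eval θ₀)) := congrFun h θ₀
  -- The numerator of a unit does not vanish on the disc either.
  have ha : a.map (MvPolynomial.eval θ₀) ∈ nonvanishingOnDisc := by
    obtain ⟨b, r, hr, hbr⟩ := hinv
    have h1 : a.map (MvPolynomial.eval θ₀) * b = q.map (MvPolynomial.eval θ₀) * r := by
      apply invSubst_injective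
      rw [map_mul, map_mul, ← haq, ← hbr]
      field_simp
    intro w hw hz
    have h2 := (nonvanishingOnDisc.mul_mem hqθ hr) w hw
    rw [← h1, map_mul, hz, zero_mul] at h2
    exact h2 rfl
  filter_upwards [eventually_nonvanishingOnDisc ha, eventually_nonvanishingOnDisc hqθ]
    with θ hθ hθ'
  have h3 : f θ * invSubst (q.map (MvPolynomial.eval θ)) =
    invSubst (a.map (MvPolynomial.eval θ)) := congrFun h θ
  have hne : ∀ b ∈ nonvanishingOnDisc, invSubst b ≠ 0 := by
    intro b hb h0
    rw [(map_eq_zero_iff _ invSubst_injective).1 h0] at hb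
    exact hb 0 (by simp) (by simp)
  have hfne : f θ ≠ 0 := by
    intro h0
    rw [h0, zero_mul] at h3
    exact hne _ hθ h3.symm
  refine ⟨hfne, q.map (MvPolynomial.eval θ), _, hθ, ?_⟩
  rw [← h3, inv_mul_cancel_left₀ hfne]

/-- A rational family that is nonzero somewhere is nonzero almost everywhere. -/
theorem ae_ne_zero_of_ratFamilies [Fintype ι] {f : (ι → ℝ) → RatFunc ℝ} {θ₀ : ι → ℝ}
    (hf : f ∈ ratFamilies θ₀) (h0 : f θ₀ ≠ 0) :
    ∀ᵐ θ ∂(MeasureTheory.volume : MeasureTheory.Measure (ι → ℝ)), f θ ≠ 0 := by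
  obtain ⟨a, q, hq, h⟩ := hf
  have hqθ : q.map (MvPolynomial.eval θ₀) ≠ 0 := mem_nonZeroDivisors_iff_ne_zero.1 hq
  have h1 : f θ₀ * invSubst (q.map (MvPolynomial.eval θ₀)) =
    invSubst (a.map (MvPolynomial.eval θ₀)) := congrFun h θ₀
  have ha : a ≠ 0 := by
    rintro rfl
    rw [Polynomial.map_zero, map_zero] at h1
    exact mul_ne_zero h0 ((map_ne_zero_iff _ invSubst_injective).2 hqθ) h1
  filter_upwards [ae_eval_ne_zero a.leadingCoeff (Polynomial.leadingCoeff_ne_zero.2 ha)]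
    with θ hθ hfθ
  apply hθ
  have h2 : f θ * invSubst (q.map (MvPolynomial.eval θ)) =
    invSubst (a.map (MvPolynomial.eval θ)) := congrFun h θ
  rw [hfθ, zero_mul] at h2
  have h3 := (map_eq_zero_iff _ invSubst_injective).1 h2.symm
  have h4 := congrArg (fun m => Polynomial.coeff m a.natDegree) h3
  simpa [Polynomial.coeff_map] using h4

namespace ModelSet

variable {L K p : ℕ} {S : ModelSet L K p} {ν : S.ParEntry → ℕ}

/-! ### The parametrization -/

/-- The varying part of a parametrized entry. -/
noncomputable def varying (ν : S.ParEntry → ℕ) (θ : S.ParIndex ν → ℝ) (e : S.ParEntry) :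
    RatFunc ℝ :=
  algebraMap ℝ[X] (RatFunc ℝ) (S.numPoly ν θ e) / algebraMap ℝ[X] (RatFunc ℝ) (S.denomPoly ν θ e)

theorem entryAt_of_mem {θ : S.ParIndex ν → ℝ} {j : Fin L} {s : Signal L K p} (h : s ∈ S.par j) :
    S.entryAt ν θ j s = offset (j, s) + varying ν θ ⟨(j, s), h⟩ := by
  rw [entryAt, dif_pos h, varying]

theorem entryAt_of_notMem {θ : S.ParIndex ν → ℝ} {j : Fin L} {s : Signal L K p}
    (h : s ∉ S.par j) : S.entryAt ν θ j s = S.known j s := by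
  rw [entryAt, dif_neg h]

theorem degree_sum_lt (θ : S.ParIndex ν → ℝ) (e : S.ParEntry) :
    (∑ k : Fin (ν e), Polynomial.C (θ (.inl ⟨e, .inl k⟩)) *
      (Polynomial.X : ℝ[X]) ^ (k : ℕ)).degree < ν e :=
  (Polynomial.degree_sum_fin_lt (fun k : Fin (ν e) => θ (.inl ⟨e, .inl k⟩)))

theorem monic_denomPoly (θ : S.ParIndex ν → ℝ) (e : S.ParEntry) : (S.denomPoly ν θ e).Monic :=
  Polynomial.monic_X_pow_add (degree_sum_lt θ e)

theorem natDegree_denomPoly (θ : S.ParIndex ν → ℝ) (e : S.ParEntry) :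
    (S.denomPoly ν θ e).natDegree = ν e :=
  Polynomial.natDegree_eq_of_degree_eq_some (by
    rw [denomPoly, Polynomial.degree_add_eq_left_of_degree_lt, Polynomial.degree_X_pow]
    rw [Polynomial.degree_X_pow]
    exact degree_sum_lt θ e)

theorem degree_numPoly_lt (θ : S.ParIndex ν → ℝ) (e : S.ParEntry) :
    (S.numPoly ν θ e).degree < S.numCoeffs (ν e) e.1 :=
  Polynomial.degree_sum_fin_lt (fun k : Fin (S.numCoeffs (ν e) e.1) => θ (.inl ⟨e, .inr k⟩))

theorem natDegree_numPoly_le (θ : S.ParIndex ν → ℝ) (e : S.ParEntry) :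
    (S.numPoly ν θ e).natDegree ≤ ν e := by
  rw [Polynomial.natDegree_le_iff_coeff_eq_zero]
  intro N hN
  refine Polynomial.coeff_eq_zero_of_degree_lt ((degree_numPoly_lt θ e).trans_le ?_)
  rw [Nat.cast_le, numCoeffs]
  split_ifs <;> omega

theorem varying_mul (θ : S.ParIndex ν → ℝ) (e : S.ParEntry) :
    varying ν θ e * invSubst ((S.denomPoly ν θ e).reflect (ν e)) =
      invSubst ((S.numPoly ν θ e).reflect (ν e)) :=
  div_mul_invSubst_reflect (monic_denomPoly θ e).ne_zero (natDegree_numPoly_le θ e)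
    (natDegree_denomPoly θ e).le

theorem coeff_zero_reflect_denomPoly (θ : S.ParIndex ν → ℝ) (e : S.ParEntry) :
    ((S.denomPoly ν θ e).reflect (ν e)).coeff 0 = 1 := by
  rw [Polynomial.coeff_reflect, Polynomial.revAt_zero]
  have := (monic_denomPoly θ e).coeff_natDegree
  rwa [natDegree_denomPoly] at this

theorem isProper_varying (θ : S.ParIndex ν → ℝ) (e : S.ParEntry) : IsProper (varying ν θ e) :=
  isProper_of_mul_eq (by rw [coeff_zero_reflect_denomPoly]; exact one_ne_zero) (varying_mul θ e)

theorem valueAtInfinity_varying (θ : S.ParIndex ν → ℝ) (e : S.ParEntry) :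
    valueAtInfinity (varying ν θ e) = (S.numPoly ν θ e).coeff (ν e) := by
  rw [valueAtInfinity_eq (by rw [coeff_zero_reflect_denomPoly]; exact one_ne_zero)
    (varying_mul θ e), coeff_zero_reflect_denomPoly, Polynomial.coeff_reflect,
    Polynomial.revAt_zero, div_one]

theorem isStrictlyProper_varying (θ : S.ParIndex ν → ℝ) (e : S.ParEntry)
    (he : S.varFeed e.1 = false) : IsStrictlyProper (varying ν θ e) := by
  rw [isStrictlyProper_iff_valueAtInfinity, valueAtInfinity_varying]
  refine ⟨isProper_varying θ e, Polynomial.coeff_eq_zero_of_degree_lt ?_⟩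
  simpa [numCoeffs, he] using degree_numPoly_lt θ e

/-- The denominator of a parametrized entry in the variable `z⁻¹`, with coefficients that are
polynomials in the parameters. -/
noncomputable def denomFamily (ν : S.ParEntry → ℕ) (e : S.ParEntry) :
    (MvPolynomial (S.ParIndex ν) ℝ)[X] :=
  Polynomial.reflect (ν e) (Polynomial.X ^ ν e + ∑ k : Fin (ν e),
    Polynomial.C (MvPolynomial.X (.inl ⟨e, .inl k⟩)) * Polynomial.X ^ (k : ℕ))

theorem map_denomFamily (θ : S.ParIndex ν → ℝ) (e : S.ParEntry) :
    (denomFamily ν e).map (MvPolynomial.eval θ) = (S.denomPoly ν θ e).reflect (ν e) := by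
  rw [denomFamily, ← Polynomial.reflect_map, denomPoly]
  simp [Polynomial.map_sum]

/-- The numerator of a parametrized entry in the variable `z⁻¹`, with coefficients that are
polynomials in the parameters. -/
noncomputable def numFamily (ν : S.ParEntry → ℕ) (e : S.ParEntry) :
    (MvPolynomial (S.ParIndex ν) ℝ)[X] :=
  Polynomial.reflect (ν e) (∑ k : Fin (S.numCoeffs (ν e) e.1),
    Polynomial.C (MvPolynomial.X (.inl ⟨e, .inr k⟩)) * Polynomial.X ^ (k : ℕ))

theorem map_numFamily (θ : S.ParIndex ν → ℝ) (e : S.ParEntry) :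
    (numFamily ν e).map (MvPolynomial.eval θ) = (S.numPoly ν θ e).reflect (ν e) := by
  rw [numFamily, ← Polynomial.reflect_map, numPoly]
  simp [Polynomial.map_sum]

theorem varying_mul_family (e : S.ParEntry) :
    (fun θ => varying ν θ e) * family (S.ParIndex ν) (denomFamily ν e) =
      family (S.ParIndex ν) (numFamily ν e) := by
  ext1 θ
  rw [Pi.mul_apply, family_apply, family_apply, map_denomFamily, map_numFamily, varying_mul]

theorem varying_mem_ratFamilies (θ₀ : S.ParIndex ν → ℝ) (e : S.ParEntry) :
    (fun θ => varying ν θ e) ∈ ratFamilies θ₀ := by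
  refine ⟨numFamily ν e, denomFamily ν e, ?_, varying_mul_family e⟩
  change (denomFamily ν e).map (MvPolynomial.eval θ₀) ∈ nonZeroDivisors ℝ[X]
  rw [map_denomFamily, mem_nonZeroDivisors_iff_ne_zero, Ne, Polynomial.reflect_eq_zero_iff]
  exact (monic_denomPoly θ₀ e).ne_zero

theorem varying_mem_stableFamilies {θ₀ : S.ParIndex ν → ℝ} {e : S.ParEntry}
    (h : (S.denomPoly ν θ₀ e).reflect (ν e) ∈ nonvanishingOnDisc) :
    (fun θ => varying ν θ e) ∈ stableFamilies θ₀ := by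
  refine ⟨numFamily ν e, denomFamily ν e, ?_, varying_mul_family e⟩
  change (denomFamily ν e).map (MvPolynomial.eval θ₀) ∈ nonvanishingOnDisc
  rwa [map_denomFamily]

theorem entryAt_mem_ratFamilies (θ₀ : S.ParIndex ν → ℝ) (j : Fin L) (s : Signal L K p) :
    (fun θ => S.entryAt ν θ j s) ∈ ratFamilies θ₀ := by
  by_cases h : s ∈ S.par j
  · simp_rw [entryAt_of_mem h]
    exact (ratFamilies θ₀).add_mem (const_mem_ratFamilies _ _) (varying_mem_ratFamilies θ₀ _)
  · simp_rw [entryAt_of_notMem h]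
    exact const_mem_ratFamilies _ _

/-! ### Generic rank -/

variable (S) in
/-- The matrix `[I - G(θ), R(θ), H(θ)]`. -/
noncomputable def systemAt (ν : S.ParEntry → ℕ) (θ : S.ParIndex ν → ℝ) :
    Matrix (Fin L) (Signal L K p) (RatFunc ℝ) :=
  Matrix.fromCols (1 - (S.modelAt ν θ).G) (S.modelAt ν θ).U

theorem systemAt_inl (θ : S.ParIndex ν → ℝ) (j l : Fin L) :
    S.systemAt ν θ j (.inl l) = (1 : Matrix (Fin L) (Fin L) (RatFunc ℝ)) j l -
      S.entryAt ν θ j (.inl l) := rfl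

theorem modelAt_U (θ : S.ParIndex ν → ℝ) (j : Fin L) (u : Excitation K p) :
    (S.modelAt ν θ).U j u = S.entryAt ν θ j (.inr u) := by
  rcases u with k | m <;> rfl

theorem systemAt_inr (θ : S.ParIndex ν → ℝ) (j : Fin L) (u : Excitation K p) :
    S.systemAt ν θ j (.inr u) = S.entryAt ν θ j (.inr u) := modelAt_U θ j u

theorem entry_modelAt (θ : S.ParIndex ν → ℝ) : (S.modelAt ν θ).entry = S.entryAt ν θ := by
  ext1 j s
  rcases s with l | u
  · rfl
  · exact modelAt_U θ j u

theorem systemAt_eq_of_notMem (θ : S.ParIndex ν → ℝ) {j : Fin L} {s : Signal L K p}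
    (h : s ∉ S.par j) : S.systemAt ν θ j s = S.knownSystem j s := by
  rcases s with l | u
  · rw [systemAt_inl, entryAt_of_notMem h]; rfl
  · rw [systemAt_inr, entryAt_of_notMem h]; rfl

theorem systemAt_mem_ratFamilies (θ₀ : S.ParIndex ν → ℝ) (j : Fin L) (s : Signal L K p) :
    (fun θ => S.systemAt ν θ j s) ∈ ratFamilies θ₀ := by
  rcases s with l | u
  · simp_rw [systemAt_inl]
    exact (ratFamilies θ₀).sub_mem (const_mem_ratFamilies _ _) (entryAt_mem_ratFamilies _ _ _)
  · simp_rw [systemAt_inr]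
    exact entryAt_mem_ratFamilies _ _ _

/-- The parameter vector for which the varying part of each entry `e` is `t e * z ^ (-ν e)`. -/
noncomputable def monomialParam (ν : S.ParEntry → ℕ) (t : S.ParEntry → ℝ) : S.ParIndex ν → ℝ
  | .inl ⟨_, .inl _⟩ => 0
  | .inl ⟨e, .inr k⟩ => if (k : ℕ) = 0 then t e else 0
  | .inr _ => 0

theorem varying_monomialParam (hν : ∀ e, 1 ≤ ν e) (t : S.ParEntry → ℝ) (e : S.ParEntry) :
    varying ν (monomialParam ν t) e = RatFunc.C (t e) / RatFunc.X ^ ν e := by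
  have hn : S.numPoly ν (monomialParam ν t) e = Polynomial.C (t e) := by
    have hpos : 0 < S.numCoeffs (ν e) e.1 := by
      rw [numCoeffs]; have := hν e; omega
    rw [numPoly, Finset.sum_eq_single ⟨0, hpos⟩]
    · simp [monomialParam]
    · intro k _ hk
      have : (k : ℕ) ≠ 0 := fun h => hk (Fin.ext h)
      simp [monomialParam, this]
    · simp
  have hd : S.denomPoly ν (monomialParam ν t) e = Polynomial.X ^ ν e := by
    rw [denomPoly]
    simp [monomialParam]
  rw [varying, hn, hd, map_pow, RatFunc.algebraMap_X, RatFunc.algebraMap_C]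

theorem systemAt_monomialParam_eq {hν : ∀ e, 1 ≤ ν e} {t t' : S.ParEntry → ℝ} {j : Fin L}
    {s : Signal L K p} (h : s ∈ S.par j) :
    S.systemAt ν (monomialParam ν t) j s = S.systemAt ν (monomialParam ν t') j s ↔
      t ⟨(j, s), h⟩ = t' ⟨(j, s), h⟩ := by
  have hX : (RatFunc.X : RatFunc ℝ) ^ ν ⟨(j, s), h⟩ ≠ 0 := pow_ne_zero _ RatFunc.X_ne_zero
  have key : S.entryAt ν (monomialParam ν t) j s = S.entryAt ν (monomialParam ν t') j s ↔
      t ⟨(j, s), h⟩ = t' ⟨(j, s), h⟩ := by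
    rw [entryAt_of_mem h, entryAt_of_mem h, add_right_inj, varying_monomialParam hν,
      varying_monomialParam hν, div_left_inj' hX, (RatFunc.C_injective (K := ℝ)).eq_iff]
  rcases s with l | u
  · rw [systemAt_inl, systemAt_inl, sub_right_inj, key]
  · rw [systemAt_inr, systemAt_inr, key]

theorem known_self (hne : S.models.Nonempty) (j : Fin L) : S.known j (.inl j) = 0 := by
  obtain ⟨M, hM⟩ := hne
  rw [← hM.2.1 j _ (S.self_notMem j)]
  exact hM.1.G_diag j

theorem knownSystem_ne_zero (hne : S.models.Nonempty) {j : Fin L} {s : Signal L K p}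
    (h : s = .inl j ∨ S.HasEdge j s) : s ∈ S.par j ∨ S.knownSystem j s ≠ 0 := by
  by_cases hs : s ∈ S.par j
  · exact Or.inl hs
  right
  rcases s with l | u
  · by_cases hl : l = j
    · subst hl
      simp [knownSystem, known_self hne]
    · have h1 : S.known j (.inl l) ≠ 0 :=
        (h.resolve_left fun h => hl (Sum.inl.inj h)).resolve_left hs
      simpa [knownSystem, Matrix.one_apply_ne (Ne.symm hl)] using h1
  · exact (h.resolve_left (by simp)).resolve_left hs

/-- Columns with a transversal are linearly independent for some choice of the numerator constants
`t e ∈ {0, 1}`, hence for almost all parameters. -/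
theorem ae_det_ne_zero (hne : S.models.Nonempty) (hknown : S.KnownNondegenerate)
    (hν : ∀ e, 1 ≤ ν e) {c : Fin L → Signal L K p} (hc : Function.Injective c)
    {σ : Equiv.Perm (Fin L)} (hσ : S.IsTransversal c σ) :
    ∀ᵐ θ : S.ParIndex ν → ℝ ∂MeasureTheory.volume,
      ((S.systemAt ν θ).submatrix id c).det ≠ 0 := by
  classical
  obtain ⟨B, hB, hdet⟩ := exists_completion_det_ne_zero (par := fun j s => s ∈ S.par j)
    (known := S.knownSystem) (v₀ := S.systemAt ν (monomialParam ν fun _ => 0))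
    (v₁ := S.systemAt ν (monomialParam ν fun _ => 1))
    (fun j s h => by
      rw [Ne, systemAt_monomialParam_eq (hν := hν) h]
      exact zero_ne_one)
    (fun n r c h1 h2 => hknown n r c h1 h2) (σ.toEmbedding) ⟨c, hc⟩
    (fun a => knownSystem_ne_zero hne (hσ a))
  let t : S.ParEntry → ℝ := fun e =>
    if B e.1.1 e.1.2 = S.systemAt ν (monomialParam ν fun _ => 0) e.1.1 e.1.2 then 0 else 1
  have ht : S.systemAt ν (monomialParam ν t) = B := by
    ext1 j s
    by_cases hs : s ∈ S.par j
    · by_cases h0 : B j s = S.systemAt ν (monomialParam ν fun _ => 0) j s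
      · rw [h0, systemAt_monomialParam_eq (hν := hν) hs]
        simp [t, h0]
      · rw [((hB j s).2 hs).resolve_left h0, systemAt_monomialParam_eq (hν := hν) hs]
        simp [t, h0]
    · rw [systemAt_eq_of_notMem _ hs, (hB j s).1 hs]
  have h0 : ((S.systemAt ν (monomialParam ν t)).submatrix id c).det ≠ 0 := by
    intro h
    apply hdet
    have := Matrix.det_permute σ ((S.systemAt ν (monomialParam ν t)).submatrix id c)
    rw [h, mul_zero, ht] at this
    exact this
  exact ae_ne_zero_of_ratFamilies (f := fun θ => ((S.systemAt ν θ).submatrix id c).det)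
    (det_family_mem _ fun i j => systemAt_mem_ratFamilies _ _ _) h0

/-- In almost all models the rank of a submatrix of `T` is at least the number of disjoint paths. -/
theorem forAlmostAll_le_rank (hne : S.models.Nonempty) (hknown : S.KnownNondegenerate)
    (j : Fin L) (Y' : Finset (Fin L)) {n : ℕ} (h : S.HasDisjointPaths (S.UU j) Y' n) :
    S.ForAlmostAll fun M => n ≤ (S.subT j Y' M).rank := by
  intro ν hν
  obtain ⟨c, hc, rfl, σ, hσ⟩ := h.exists_isTransversal
  filter_upwards [ae_det_ne_zero hne hknown hν hc.injective hσ] with θ hθ hM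
  exact linkCard_le_rank hM.1.det_ne_zero _ hc hθ

end ModelSet

/-! ### The valid parameter vectors form a neighbourhood -/

theorem valueAtInfinity_C (r : ℝ) : valueAtInfinity (RatFunc.C r) = r := by
  have h : RatFunc.C r * invSubst 1 = invSubst (Polynomial.C r) := by
    rw [map_one, mul_one, invSubst_C]
  rw [valueAtInfinity_eq (by simp) h]
  simp

/-- Positive definiteness is an open condition on symmetric matrices, because the unit sphere is
compact. -/
theorem eventually_posDef {Θ : Type*} [TopologicalSpace Θ] {n : ℕ}
    {A : Θ → Matrix (Fin n) (Fin n) ℝ} (hA : Continuous A) (hsymm : ∀ θ, (A θ).IsHermitian)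
    {θ₀ : Θ} (h0 : (A θ₀).PosDef) : ∀ᶠ θ in nhds θ₀, (A θ).PosDef := by
  have hcont : Continuous fun z : Θ × (Fin n → ℝ) => z.2 ⬝ᵥ (A z.1).mulVec z.2 :=
    continuous_snd.dotProduct ((hA.comp continuous_fst).matrix_mulVec continuous_snd)
  have h := (isCompact_sphere (0 : Fin n → ℝ) 1).eventually_forall_of_forall_eventually (x₀ := θ₀)
    (P := fun θ x => 0 < x ⬝ᵥ (A θ).mulVec x) (by
      intro x hx
      have hx0 : x ≠ 0 := by
        rintro rfl
        simp at hx
      have := h0.dotProduct_mulVec_pos hx0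
      rw [star_trivial] at this
      exact hcont.continuousAt.eventually (lt_mem_nhds this))
  filter_upwards [h] with θ hθ
  refine Matrix.PosDef.of_dotProduct_mulVec_pos (hsymm θ) fun x hx => ?_
  have hnorm : 0 < ‖x‖ := norm_pos_iff.2 hx
  have h1 := hθ (‖x‖⁻¹ • x) (by
    rw [mem_sphere_zero_iff_norm, norm_smul, norm_inv, norm_norm, inv_mul_cancel₀ hnorm.ne'])
  rw [Matrix.mulVec_smul, smul_dotProduct, dotProduct_smul, smul_smul, smul_eq_mul] at h1
  rw [star_trivial]
  exact pos_of_mul_pos_right h1 (by positivity)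

theorem inv_apply_mem {n : Type*} [Fintype n] [DecidableEq n] {R : Subring (RatFunc ℝ)}
    {A : Matrix n n (RatFunc ℝ)} (hA : ∀ i j, A i j ∈ R) (hdet : A.det⁻¹ ∈ R) (i j : n) :
    A⁻¹ i j ∈ R := by
  rw [Matrix.inv_def, Ring.inverse_eq_inv', Matrix.smul_apply, smul_eq_mul]
  exact R.mul_mem hdet (adjugate_mem R hA i j)

namespace NetworkModel

variable {L K p : ℕ} {M : NetworkModel L K p}

theorem IsValid.G_mem (hM : M.IsValid) (j l : Fin L) : M.G j l ∈ stableRing :=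
  isProper_and_isStable_iff.1 ⟨hM.G_proper j l, hM.G_stable j l⟩

theorem IsValid.H_mem (hM : M.IsValid) (j : Fin L) (m : Fin p) : M.H j m ∈ stableRing :=
  isProper_and_isStable_iff.1 ⟨hM.H_proper j m, hM.H_stable j m⟩

theorem IsValid.inv_mem (hM : M.IsValid) (j l : Fin L) : (1 - M.G)⁻¹ j l ∈ stableRing :=
  isProper_and_isStable_iff.1 ⟨hM.inv_proper j l, hM.inv_stable j l⟩

end NetworkModel

namespace ModelSet

variable {L K p : ℕ} {S : ModelSet L K p} {ν : S.ParEntry → ℕ}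

theorem offset_mem (e : Fin L × Signal L K p) : offset e ∈ stableRing := by
  rcases e with ⟨j, l | k | m⟩
  · exact stableRing.zero_mem
  · exact stableRing.zero_mem
  · simp only [offset]
    split_ifs
    exacts [stableRing.one_mem, stableRing.zero_mem]

theorem valueAtInfinity_offset (j : Fin L) (m : Fin p) :
    valueAtInfinity (offset (K := K) (j, .inr (.inr m))) =
      if (j : ℕ) = (m : ℕ) then 1 else 0 := by
  simp only [offset]
  split_ifs
  · simpa using valueAtInfinity_C 1
  · simpa using valueAtInfinity_C 0

theorem isProper_entry {M : NetworkModel L K p} (hM : M.IsValid) (j : Fin L)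
    (s : Signal L K p) : IsProper (M.entry j s) := by
  rcases s with l | k | m
  exacts [hM.G_proper j l, hM.R_proper j k, hM.H_proper j m]

theorem isProper_entry_sub {M : NetworkModel L K p} (hM : M.IsValid)
    (e : Fin L × Signal L K p) : IsProper (M.entry e.1 e.2 - offset e) :=
  isProper_iff.2 (properRing.sub_mem (isProper_iff.1 (isProper_entry hM _ _))
    (stableRing_le_properRing (offset_mem e)))

theorem isStrictlyProper_entry_sub {M : NetworkModel L K p} (hM : M ∈ S.models)
    (e : S.ParEntry) (he : S.varFeed e.1 = false) :
    IsStrictlyProper (M.entry e.1.1 e.1.2 - offset e.1) := by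
  obtain ⟨⟨j, l | k | m⟩, h⟩ := e
  · have hl : l ∉ S.feed j := by simpa [varFeed] using he
    change IsStrictlyProper (M.G j l - 0)
    rw [sub_zero]
    exact hM.2.2.1 j l h hl
  · simp [varFeed] at he
  · have hj : (j : ℕ) < p := by simpa [varFeed] using he
    rw [isStrictlyProper_iff_valueAtInfinity]
    refine ⟨isProper_entry_sub hM.1 _, ?_⟩
    have h1 : valueAtInfinity (M.entry j (.inr (.inr m))) =
        valueAtInfinity (offset (K := K) (j, .inr (.inr m))) := by
      rw [valueAtInfinity_offset]
      exact hM.1.H_monic j m hj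
    have h2 := valueAtInfinity_add (isProper_entry_sub hM.1 (j, .inr (.inr m)))
      (isProper_iff.2 (stableRing_le_properRing (offset_mem (K := K) (j, .inr (.inr m)))))
    rw [sub_add_cancel, h1] at h2
    exact right_eq_add.1 h2

theorem reflect_X_mul {d : ℝ[X]} : (Polynomial.X * d).reflect (d.natDegree + 1) =
    d.reflect d.natDegree := by
  rw [add_comm, Polynomial.reflect_mul _ _ Polynomial.natDegree_X_le le_rfl]
  simp

theorem sum_fin_coeff (d : ℝ[X]) (n : ℕ) :
    ∑ k : Fin n, Polynomial.C (d.coeff k) * Polynomial.X ^ (k : ℕ) =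
      ∑ k ∈ Finset.range n, Polynomial.C (d.coeff k) * Polynomial.X ^ k :=
  Fin.sum_univ_eq_sum_range (fun k => Polynomial.C (d.coeff k) * Polynomial.X ^ k) n

/-- Every model of the set is a point of the parametrization of some orders. Numerators and
denominators are multiplied by `z`, which makes all orders positive and keeps stable entries
stable. -/
theorem exists_param {M : NetworkModel L K p} (hM : M ∈ S.models) :
    ∃ ν : S.ParEntry → ℕ, (∀ e, 1 ≤ ν e) ∧ ∃ θ : S.ParIndex ν → ℝ,
      S.entryAt ν θ = M.entry ∧ (S.modelAt ν θ).Λ = M.Λ ∧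
      ∀ e : S.ParEntry, M.entry e.1.1 e.1.2 ∈ stableRing →
        (S.denomPoly ν θ e).reflect (ν e) ∈ nonvanishingOnDisc := by
  let g : S.ParEntry → RatFunc ℝ := fun e => M.entry e.1.1 e.1.2 - offset e.1
  let ν : S.ParEntry → ℕ := fun e => (g e).denom.natDegree + 1
  have hsymm : ∀ a b, M.Λ a b = M.Λ b a := fun a b => by
    simpa using hM.1.Λ_posDef.isHermitian.apply b a
  let θ : S.ParIndex ν → ℝ := fun x => match x with
    | .inl ⟨e, .inl k⟩ => (Polynomial.X * (g e).denom).coeff k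
    | .inl ⟨e, .inr k⟩ => (Polynomial.X * (g e).num).coeff k
    | .inr x => Sym2.lift ⟨fun a b => M.Λ a b, hsymm⟩ x
  have hd0 : ∀ e, (Polynomial.X * (g e).denom).natDegree = ν e := fun e => by
    rw [Polynomial.natDegree_X_mul (g e).denom_ne_zero]
  have hd : ∀ e, S.denomPoly ν θ e = Polynomial.X * (g e).denom := fun e => by
    have h1 : (Polynomial.X * (g e).denom).Monic := Polynomial.monic_X.mul (g e).monic_denom
    have h2 := h1.as_sum
    rw [hd0, ← sum_fin_coeff] at h2
    rw [h2]
    rfl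
  have hn : ∀ e, S.numPoly ν θ e = Polynomial.X * (g e).num := fun e => by
    have hlt : (Polynomial.X * (g e).num).natDegree < S.numCoeffs (ν e) e.1 := by
      have h1 : (g e).num.natDegree ≤ (g e).denom.natDegree :=
        Polynomial.natDegree_le_natDegree (isProper_entry_sub hM.1 e.1)
      by_cases h0 : (g e).num = 0
      · simp [h0, numCoeffs, ν]
      · rw [Polynomial.natDegree_X_mul h0, numCoeffs]
        cases he : S.varFeed e.1
        · have := Polynomial.natDegree_lt_natDegree h0 (isStrictlyProper_entry_sub hM e he)
          simpa [ν] using this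
        · simp only [if_true, ν]
          omega
    have h2 := Polynomial.as_sum_range' _ _ hlt
    simp_rw [← Polynomial.C_mul_X_pow_eq_monomial] at h2
    rw [← sum_fin_coeff] at h2
    rw [h2]
    rfl
  have hX : algebraMap ℝ[X] (RatFunc ℝ) Polynomial.X ≠ 0 := by
    rw [RatFunc.algebraMap_X]; exact RatFunc.X_ne_zero
  refine ⟨ν, fun e => Nat.le_add_left _ _, θ, ?_, ?_, ?_⟩
  · ext1 j s
    by_cases hs : s ∈ S.par j
    · rw [entryAt_of_mem hs, varying, hn, hd, map_mul, map_mul, mul_div_mul_left _ _ hX,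
        RatFunc.num_div_denom]
      exact add_sub_cancel _ _
    · rw [entryAt_of_notMem hs, hM.2.1 j s hs]
  · ext a b
    simp only [modelAt]
    split_ifs with h
    · rfl
    · push Not at h
      exact (hM.2.2.2 (by simpa using h.2) h.1).symm
  · intro e he
    have hg : g e ∈ stableRing := stableRing.sub_mem he (offset_mem _)
    rw [hd, reflect_X_mul]
    exact reflect_denom_mem (isProper_and_isStable_iff.2 hg).2

theorem entryAt_mem_stableFamilies {θ₀ : S.ParIndex ν → ℝ} {j : Fin L} {s : Signal L K p}
    (hstable : S.entryAt ν θ₀ j s ∈ stableRing)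
    (hd : ∀ h : s ∈ S.par j,
      (S.denomPoly ν θ₀ ⟨(j, s), h⟩).reflect (ν ⟨(j, s), h⟩) ∈ nonvanishingOnDisc) :
    (fun θ => S.entryAt ν θ j s) ∈ stableFamilies θ₀ := by
  by_cases h : s ∈ S.par j
  · simp_rw [entryAt_of_mem h]
    exact (stableFamilies θ₀).add_mem (const_mem_stableFamilies (offset_mem _) _)
      (varying_mem_stableFamilies (hd h))
  · rw [entryAt_of_notMem h] at hstable
    simp_rw [entryAt_of_notMem h]
    exact const_mem_stableFamilies hstable _

theorem isProper_entryAt {M : NetworkModel L K p} (hM : M ∈ S.models) (θ : S.ParIndex ν → ℝ)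
    (j : Fin L) (s : Signal L K p) : IsProper (S.entryAt ν θ j s) := by
  by_cases h : s ∈ S.par j
  · rw [entryAt_of_mem h]
    exact isProper_iff.2 (properRing.add_mem (stableRing_le_properRing (offset_mem _))
      (isProper_iff.1 (isProper_varying _ _)))
  · rw [entryAt_of_notMem h, ← hM.2.1 j s h]
    exact isProper_entry hM.1 j s

theorem continuous_valueAtInfinity_entryAt (j l : Fin L) :
    Continuous fun θ : S.ParIndex ν → ℝ => valueAtInfinity (S.entryAt ν θ j (.inl l)) := by
  by_cases h : Sum.inl l ∈ S.par j
  · simp_rw [entryAt_of_mem h]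
    have : ∀ θ : S.ParIndex ν → ℝ,
        valueAtInfinity (offset (K := K) (p := p) (j, .inl l) + varying ν θ ⟨(j, .inl l), h⟩) =
          (S.numPoly ν θ ⟨(j, .inl l), h⟩).coeff (ν ⟨(j, .inl l), h⟩) := fun θ => by
      rw [← valueAtInfinity_varying]
      simp [offset]
    simp_rw [this]
    simp only [numPoly, Polynomial.finsetSum_coeff, Polynomial.coeff_C_mul]
    fun_prop
  · simp_rw [entryAt_of_notMem h]
    exact continuous_const

theorem isStrictlyProper_entryAt (θ : S.ParIndex ν → ℝ) {j l : Fin L}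
    (h : Sum.inl l ∈ S.par j) (hl : l ∉ S.feed j) :
    IsStrictlyProper (S.entryAt ν θ j (.inl l)) := by
  rw [entryAt_of_mem h]
  simpa [offset] using isStrictlyProper_varying θ ⟨(j, .inl l), h⟩ (by simpa [varFeed] using hl)

theorem valueAtInfinity_entryAt_noise {M : NetworkModel L K p} (hM : M ∈ S.models)
    (θ : S.ParIndex ν → ℝ) (j : Fin L) (m : Fin p) (hj : (j : ℕ) < p) :
    valueAtInfinity (S.entryAt ν θ j (.inr (.inr m))) =
      if (j : ℕ) = (m : ℕ) then 1 else 0 := by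
  by_cases h : Sum.inr (Sum.inr m) ∈ S.par j
  · rw [entryAt_of_mem h, valueAtInfinity_add_of_isStrictlyProper
      (isProper_iff.2 (stableRing_le_properRing (offset_mem _)))
      (isStrictlyProper_varying θ _ (by simpa [varFeed] using hj)), valueAtInfinity_offset]
  · rw [entryAt_of_notMem h, ← hM.2.1 j _ h]
    exact hM.1.H_monic j m hj

theorem eventually_wellPosed {Θ : Type*} [TopologicalSpace Θ]
    {A : Θ → Matrix (Fin L) (Fin L) ℝ} (hA : Continuous A) {θ₀ : Θ} (h0 : (A θ₀).det ≠ 0)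
    (h : ∀ s : Finset (Fin L), ((A θ₀)⁻¹.submatrix (fun a : s => (a : Fin L))
      (fun a : s => (a : Fin L))).det ≠ 0) :
    ∀ᶠ θ in nhds θ₀, (A θ).det ≠ 0 ∧
      ∀ s : Finset (Fin L), ((A θ)⁻¹.submatrix (fun a : s => (a : Fin L))
        (fun a : s => (a : Fin L))).det ≠ 0 := by
  have hinv : ContinuousAt (fun θ => (A θ)⁻¹) θ₀ := by
    simp_rw [Matrix.inv_def, Ring.inverse_eq_inv']
    exact (hA.matrix_det.continuousAt.inv₀ h0).smul hA.matrix_adjugate.continuousAt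
  refine (hA.matrix_det.continuousAt.eventually_ne h0).and (Filter.eventually_all.2 fun s => ?_)
  have hs : Continuous fun B : Matrix (Fin L) (Fin L) ℝ =>
      (B.submatrix (fun a : s => (a : Fin L)) (fun a : s => (a : Fin L))).det :=
    (continuous_id.matrix_submatrix _ _).matrix_det
  exact (hs.continuousAt.comp hinv).eventually_ne (h s)

theorem eventually_inverse {θ₀ : S.ParIndex ν → ℝ}
    (hG : ∀ j l, (fun θ => S.entryAt ν θ j (.inl l)) ∈ stableFamilies θ₀)
    (h0 : (1 - (S.modelAt ν θ₀).G).det ≠ 0)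
    (hinv : ∀ j l, (1 - (S.modelAt ν θ₀).G)⁻¹ j l ∈ stableRing) :
    ∀ᶠ θ in nhds θ₀, (1 - (S.modelAt ν θ).G).det ≠ 0 ∧
      ∀ j l, (1 - (S.modelAt ν θ).G)⁻¹ j l ∈ stableRing := by
  have hdet : (fun θ => (1 - (S.modelAt ν θ).G).det) ∈ stableFamilies θ₀ := by
    refine det_family_mem _ fun j l => ?_
    exact (stableFamilies θ₀).sub_mem (const_mem_stableFamilies (by
      rw [Matrix.one_apply]
      split_ifs
      exacts [stableRing.one_mem, stableRing.zero_mem]) _) (hG j l)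
  have hdinv : ((1 - (S.modelAt ν θ₀).G).det)⁻¹ ∈ stableRing := by
    have h1 := det_mem stableRing hinv
    rwa [Matrix.det_nonsing_inv, Ring.inverse_eq_inv'] at h1
  have hGev : ∀ᶠ θ in nhds θ₀, ∀ j l, S.entryAt ν θ j (.inl l) ∈ stableRing :=
    Filter.eventually_all.2 fun j => Filter.eventually_all.2 fun l =>
      eventually_mem_stableRing (hG j l)
  filter_upwards [eventually_inv_mem_stableRing hdet h0 hdinv, hGev] with θ hθ hGθ
  exact ⟨hθ.1, inv_apply_mem (one_sub_mem _ hGθ) hθ.2⟩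

theorem eventually_leftInverse {θ₀ : S.ParIndex ν → ℝ}
    (hH : ∀ j m, (fun θ => S.entryAt ν θ j (.inr (.inr m))) ∈ stableFamilies θ₀)
    {X : Matrix (Fin p) (Fin L) (RatFunc ℝ)} (hX : ∀ m j, X m j ∈ stableRing)
    (h0 : X * (S.modelAt ν θ₀).H = 1) :
    ∀ᶠ θ in nhds θ₀, ∃ X' : Matrix (Fin p) (Fin L) (RatFunc ℝ),
      (∀ m j, X' m j ∈ stableRing) ∧ X' * (S.modelAt ν θ).H = 1 := by
  have hdet : (fun θ => (X * (S.modelAt ν θ).H).det) ∈ stableFamilies θ₀ := by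
    refine det_family_mem _ fun m m' => ?_
    have : (fun θ => (X * (S.modelAt ν θ).H) m m') =
        ∑ j, (fun _ => X m j) * fun θ => S.entryAt ν θ j (.inr (.inr m')) := by
      ext1 θ
      rw [Finset.sum_apply, Matrix.mul_apply]
      rfl
    rw [this]
    exact (stableFamilies θ₀).sum_mem fun j _ =>
      (stableFamilies θ₀).mul_mem (const_mem_stableFamilies (hX m j) _) (hH j m')
  have hHev : ∀ᶠ θ in nhds θ₀, ∀ j m, S.entryAt ν θ j (.inr (.inr m)) ∈ stableRing :=
    Filter.eventually_all.2 fun j => Filter.eventually_all.2 fun m =>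
      eventually_mem_stableRing (hH j m)
  filter_upwards [eventually_inv_mem_stableRing hdet (by simp [h0])
    (by simp [h0, stableRing.one_mem]), hHev] with θ hθ hHθ
  refine ⟨(X * (S.modelAt ν θ).H)⁻¹ * X, ?_, ?_⟩
  · exact mul_apply_mem _ (inv_apply_mem (mul_apply_mem _ hX hHθ) hθ.2) hX
  · rw [Matrix.mul_assoc, Matrix.nonsing_inv_mul _ hθ.1.isUnit]

/-- The parameter vectors of valid models contain a nonempty open set, for some choice of the
orders. -/
theorem exists_eventually_mem_models (hne : S.models.Nonempty) :
    ∃ ν : S.ParEntry → ℕ, (∀ e, 1 ≤ ν e) ∧ ∃ θ₀ : S.ParIndex ν → ℝ,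
      ∀ᶠ θ in nhds θ₀, S.modelAt ν θ ∈ S.models := by
  obtain ⟨M, hM⟩ := hne
  obtain ⟨ν, hν, θ₀, hentry, hΛ, hden⟩ := exists_param hM
  refine ⟨ν, hν, θ₀, ?_⟩
  have hG₀ : (S.modelAt ν θ₀).G = M.G := by
    ext j l
    exact congrFun (congrFun hentry j) (.inl l)
  have hH₀ : (S.modelAt ν θ₀).H = M.H := by
    ext j m
    exact congrFun (congrFun hentry j) (.inr (.inr m))
  have hG : ∀ j l, (fun θ => S.entryAt ν θ j (.inl l)) ∈ stableFamilies θ₀ := fun j l =>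
    entryAt_mem_stableFamilies (by rw [hentry]; exact hM.1.G_mem j l)
      fun h => hden ⟨(j, .inl l), h⟩ (hM.1.G_mem j l)
  have hH : ∀ j m, (fun θ => S.entryAt ν θ j (.inr (.inr m))) ∈ stableFamilies θ₀ := fun j m =>
    entryAt_mem_stableFamilies (by rw [hentry]; exact hM.1.H_mem j m)
      fun h => hden ⟨(j, .inr (.inr m)), h⟩ (hM.1.H_mem j m)
  have hGev : ∀ᶠ θ in nhds θ₀, ∀ j l, S.entryAt ν θ j (.inl l) ∈ stableRing :=
    Filter.eventually_all.2 fun j => Filter.eventually_all.2 fun l =>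
      eventually_mem_stableRing (hG j l)
  have hHev : ∀ᶠ θ in nhds θ₀, ∀ j m, S.entryAt ν θ j (.inr (.inr m)) ∈ stableRing :=
    Filter.eventually_all.2 fun j => Filter.eventually_all.2 fun m =>
      eventually_mem_stableRing (hH j m)
  have hinv := eventually_inverse hG (by rw [hG₀]; exact hM.1.det_ne_zero)
    (by rw [hG₀]; exact hM.1.inv_mem)
  obtain ⟨X, hX, hXH⟩ := hM.1.H_leftInverse
  have hleft := eventually_leftInverse hH (fun m j => isProper_and_isStable_iff.1 (hX m j))
    (by rw [hH₀]; exact hXH)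
  have hwp := eventually_wellPosed (A := fun θ : S.ParIndex ν → ℝ =>
      1 - (S.modelAt ν θ).G.map valueAtInfinity) (θ₀ := θ₀)
    (by
      refine continuous_const.sub (continuous_matrix fun j l => ?_)
      exact continuous_valueAtInfinity_entryAt j l)
    (by simp only [hG₀]; exact hM.1.wellPosed_inv)
    (by simp only [hG₀]; exact hM.1.wellPosed)
  have hpos := eventually_posDef (A := fun θ : S.ParIndex ν → ℝ => (S.modelAt ν θ).Λ) (θ₀ := θ₀)
    (by
      refine continuous_matrix fun a b => ?_
      simp only [modelAt]
      split_ifs <;> fun_prop)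
    (fun θ => by
      ext a b
      rw [Matrix.conjTranspose_apply, star_trivial]
      simp only [modelAt, Sym2.eq_swap (a := b), eq_comm (a := b)])
    (by simp only [hΛ]; exact hM.1.Λ_posDef)
  filter_upwards [hGev, hHev, hinv, hleft, hwp, hpos] with θ hGθ hHθ hinvθ hleftθ hwpθ hposθ
  refine ⟨?_, fun j s hs => ?_, fun j l hl hf => isStrictlyProper_entryAt θ hl hf, ?_⟩
  · exact
    { G_diag := fun j => by
        change S.entryAt ν θ j (.inl j) = 0
        rw [entryAt_of_notMem (S.self_notMem j)]
        exact known_self ⟨M, hM⟩ j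
      G_proper := fun j l => (isProper_and_isStable_iff.2 (hGθ j l)).1
      G_stable := fun j l => (isProper_and_isStable_iff.2 (hGθ j l)).2
      R_proper := fun j k => isProper_entryAt hM θ j _
      H_proper := fun j m => (isProper_and_isStable_iff.2 (hHθ j m)).1
      H_stable := fun j m => (isProper_and_isStable_iff.2 (hHθ j m)).2
      H_leftInverse := by
        obtain ⟨X', hX', h⟩ := hleftθ
        exact ⟨X', fun m j => isProper_and_isStable_iff.2 (hX' m j), h⟩
      H_monic := fun j m hj => valueAtInfinity_entryAt_noise hM θ j m hj
      Λ_posDef := hposθ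
      det_ne_zero := hinvθ.1
      inv_proper := fun j l => (isProper_and_isStable_iff.2 (hinvθ.2 j l)).1
      inv_stable := fun j l => (isProper_and_isStable_iff.2 (hinvθ.2 j l)).2
      wellPosed_inv := hwpθ.1
      wellPosed := hwpθ.2 }
  · rw [entry_modelAt, entryAt_of_notMem hs]
  · intro hdiag a b hab
    simp [modelAt, hab, hdiag]

/-- A property of almost all models holds for some model. -/
theorem ForAlmostAll.exists_model (hne : S.models.Nonempty) {P : NetworkModel L K p → Prop}
    (h : S.ForAlmostAll P) : ∃ M ∈ S.models, P M := by
  obtain ⟨ν, hν, θ₀, hθ₀⟩ := exists_eventually_mem_models hne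
  have hd := MeasureTheory.Measure.dense_of_ae (h ν hν)
  obtain ⟨θ, hθ, hP⟩ := hd.inter_nhds_nonempty hθ₀
  exact ⟨_, hP, hθ hP⟩

end ModelSet

/-! ### Models with the same transfer matrix -/

theorem inv_X_mem_stableRing : (RatFunc.X : RatFunc ℝ)⁻¹ ∈ stableRing := by
  rw [← invSubst_X]
  exact map_mem_fracSubring _ _ _

/-- A common multiple of the denominators in the variable `z⁻¹`, times `z⁻¹`, makes finitely many
rational functions strictly proper and stable. -/
theorem exists_scaling {ι : Type*} [Fintype ι] (x : ι → RatFunc ℝ) :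
    ∃ c : RatFunc ℝ, c ≠ 0 ∧ ∀ l, RatFunc.X * (c * x l) ∈ stableRing := by
  classical
  have h : ∀ l, ∃ a q : ℝ[X], q ≠ 0 ∧ x l * invSubst q = invSubst a := fun l => by
    have h := div_mul_invSubst_reflect (x l).denom_ne_zero
      (le_max_left (x l).num.natDegree (x l).denom.natDegree) (le_max_right _ _)
    rw [RatFunc.num_div_denom] at h
    exact ⟨_, _, Polynomial.reflect_eq_zero_iff.not.2 (x l).denom_ne_zero, h⟩
  choose a q hq haq using h
  refine ⟨invSubst (Polynomial.X * ∏ l, q l), ?_, fun l => ?_⟩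
  · rw [map_ne_zero_iff _ invSubst_injective]
    exact mul_ne_zero Polynomial.X_ne_zero (Finset.prod_ne_zero_iff.2 fun l _ => hq l)
  · have : RatFunc.X * (invSubst (Polynomial.X * ∏ l, q l) * x l) =
        invSubst ((∏ k ∈ Finset.univ.erase l, q k) * a l) := by
      rw [← Finset.mul_prod_erase _ _ (Finset.mem_univ l), map_mul, map_mul, map_mul, ← haq,
        invSubst_X]
      field_simp [RatFunc.X_ne_zero (K := ℝ)]
    rw [this]
    exact map_mem_fracSubring _ _ _

/-- A small enough perturbation of `1` is a unit of the ring of proper stable functions. -/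
theorem exists_small_unit {f : RatFunc ℝ} (hf : f ∈ stableRing) :
    ∃ t : ℝ, t ≠ 0 ∧ 1 - RatFunc.C t * f ≠ 0 ∧ (1 - RatFunc.C t * f)⁻¹ ∈ stableRing := by
  have hC : (fun θ : Unit → ℝ => RatFunc.C (θ ())) ∈ stableFamilies (0 : Unit → ℝ) := by
    have : (fun θ : Unit → ℝ => RatFunc.C (θ ())) =
        family Unit (Polynomial.C (MvPolynomial.X ())) := by
      ext1 θ
      rw [family_apply, Polynomial.map_C, MvPolynomial.eval_X, invSubst_C]
    rw [this]
    exact map_mem_fracSubring _ _ _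
  have hfam : (fun θ : Unit → ℝ => 1 - RatFunc.C (θ ()) * f) ∈ stableFamilies (0 : Unit → ℝ) :=
    (stableFamilies _).sub_mem (stableFamilies _).one_mem
      ((stableFamilies _).mul_mem hC (const_mem_stableFamilies hf _))
  have h := eventually_inv_mem_stableRing hfam (by simp) (by simp [stableRing.one_mem])
  have hc : Filter.Tendsto (fun t : ℝ => (fun _ : Unit => t)) (nhds 0) (nhds (0 : Unit → ℝ)) :=
    (continuous_pi fun _ => continuous_id).tendsto' _ _ rfl
  have h2 := ((hc.eventually h).filter_mono nhdsWithin_le_nhds).and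
    (self_mem_nhdsWithin (a := (0 : ℝ)) (s := {0}ᶜ))
  obtain ⟨t, ht, ht0⟩ := h2.exists
  exact ⟨t, ht0, ht⟩

/-- The inverse of a matrix after `y` is subtracted from row `j` (the Sherman–Morrison formula). -/
theorem sub_row_mul_eq_one {n F : Type*} [Fintype n] [DecidableEq n] [Field F]
    {A N : Matrix n n F} (hN : A * N = 1) (j : n) (y : n → F) {s : F}
    (hs : s * (1 - ∑ k, y k * N k j) = 1) :
    (A - Matrix.of fun i l => if i = j then y l else 0) *
      (N * (1 + s • ((Matrix.of fun i l => if i = j then y l else 0) * N))) = 1 := by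
  set E : Matrix n n F := Matrix.of fun i l => if i = j then y l else 0 with hE
  have hEN : ∀ i l, (E * N) i l = if i = j then ∑ k, y k * N k l else 0 := fun i l => by
    rw [Matrix.mul_apply]
    split_ifs with h <;> simp [hE, h]
  have hsq : (E * N) * (E * N) = (∑ k, y k * N k j) • (E * N) := by
    ext i l
    rw [Matrix.mul_apply, Matrix.smul_apply, smul_eq_mul]
    simp_rw [hEN]
    by_cases h : i = j
    · simp [h]
    · simp [h]
  rw [← Matrix.mul_assoc, sub_mul, hN]
  calc (1 - E * N) * (1 + s • (E * N))
      = 1 + s • (E * N) - E * N - s • ((E * N) * (E * N)) := by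
        rw [mul_add, mul_one, sub_mul, one_mul, mul_smul_comm]; abel
    _ = 1 + (s * (1 - ∑ k, y k * N k j) - 1) • (E * N) := by
        rw [hsq, smul_smul, mul_sub, mul_one, sub_smul, sub_smul, one_smul]; abel
    _ = 1 := by rw [hs, sub_self, zero_smul, add_zero]

namespace NetworkModel

variable {L K p : ℕ} {M : NetworkModel L K p}

theorem IsValid.T_mem_properRing (hM : M.IsValid) (l : Fin L) (u : Excitation K p) :
    M.T l u ∈ properRing := by
  refine mul_apply_mem _ (fun i j => stableRing_le_properRing (hM.inv_mem i j)) (fun i u => ?_) l u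
  rcases u with k | m
  exacts [isProper_iff.1 (hM.R_proper i k), isProper_iff.1 (hM.H_proper i m)]

theorem IsValid.T_mem_stableRing (hM : M.IsValid) (l : Fin L) (m : Fin p) :
    M.T l (.inr m) ∈ stableRing := by
  rw [T, Matrix.mul_apply]
  exact stableRing.sum_mem fun i _ => stableRing.mul_mem (hM.inv_mem l i) (hM.H_mem i m)

theorem IsValid.mul_T (hM : M.IsValid) : (1 - M.G) * M.T = M.U := by
  rw [T, Matrix.mul_nonsing_inv_cancel_left _ _ hM.det_ne_zero.isUnit]

/-- The model with `y` added to row `j` of `G`, and with `U` changed such that `T` is kept. -/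
noncomputable def addRow (M : NetworkModel L K p) (j : Fin L) (y : Fin L → RatFunc ℝ) :
    NetworkModel L K p where
  G := M.G + Matrix.of fun i l => if i = j then y l else 0
  R := fun i k => M.R i k - if i = j then ∑ l, y l * M.T l (.inl k) else 0
  H := fun i m => M.H i m - if i = j then ∑ l, y l * M.T l (.inr m) else 0
  Λ := M.Λ

theorem addRow_G (j : Fin L) (y : Fin L → RatFunc ℝ) (i l : Fin L) :
    (M.addRow j y).G i l = M.G i l + if i = j then y l else 0 := rfl

theorem addRow_U (j : Fin L) (y : Fin L → RatFunc ℝ) (i : Fin L) (u : Excitation K p) :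
    (M.addRow j y).U i u = M.U i u - if i = j then ∑ l, y l * M.T l u else 0 := by
  rcases u with k | m <;> rfl

theorem addRow_mul_T (hM : M.IsValid) (j : Fin L) (y : Fin L → RatFunc ℝ) :
    (1 - (M.addRow j y).G) * M.T = (M.addRow j y).U := by
  ext i u
  rw [addRow_U, ← hM.mul_T, show (M.addRow j y).G =
    M.G + Matrix.of fun i l => if i = j then y l else 0 from rfl, ← sub_sub, Matrix.sub_mul,
    Matrix.sub_apply]
  congr 1
  rw [Matrix.mul_apply]
  split_ifs with h <;> simp [h]

theorem addRow_T (hM : M.IsValid) (j : Fin L) (y : Fin L → RatFunc ℝ)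
    (hdet : (1 - (M.addRow j y).G).det ≠ 0) : (M.addRow j y).T = M.T := by
  rw [T, ← addRow_mul_T hM, Matrix.nonsing_inv_mul_cancel_left _ _ hdet.isUnit]

end NetworkModel

namespace ModelSet

variable {L K p : ℕ} {S : ModelSet L K p}

open NetworkModel in
/-- A small strictly proper stable vector `y` that annihilates the columns `𝒰_j` of `T` can be added
to row `j` of `G`. The stability of `R` is not needed: the change of `R` is a combination of entries
of `T`, which are merely proper in the columns of `R`, and `R` only has to be proper. -/
theorem addRow_mem_models {M : NetworkModel L K p} (hM : M ∈ S.models) {j : Fin L}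
    {y : Fin L → RatFunc ℝ} (hy : ∀ l, Sum.inl l ∉ S.par j → y l = 0)
    (hyT : ∀ u ∈ S.UU j, ∑ l, y l * M.T l u = 0)
    (hstable : ∀ l, RatFunc.X * y l ∈ stableRing)
    (hne : 1 - ∑ k, y k * (1 - M.G)⁻¹ k j ≠ 0)
    (hunit : (1 - ∑ k, y k * (1 - M.G)⁻¹ k j)⁻¹ ∈ stableRing) :
    M.addRow j y ∈ S.models ∧ (M.addRow j y).T = M.T := by
  have hV := hM.1
  have hyst : ∀ l, y l ∈ stableRing := fun l => by
    have := stableRing.mul_mem inv_X_mem_stableRing (hstable l)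
    rwa [inv_mul_cancel_left₀ RatFunc.X_ne_zero] at this
  set E : Matrix (Fin L) (Fin L) (RatFunc ℝ) := Matrix.of fun i l => if i = j then y l else 0
    with hE
  have hEst : ∀ i l, E i l ∈ stableRing := fun i l => by
    simp only [hE, Matrix.of_apply]
    split_ifs
    exacts [hyst l, stableRing.zero_mem]
  have hEsp : ∀ i l, IsStrictlyProper (E i l) := fun i l => by
    rw [isStrictlyProper_iff]
    simp only [hE, Matrix.of_apply]
    split_ifs
    · exact stableRing_le_properRing (hstable l)
    · rw [mul_zero]; exact properRing.zero_mem
  have hTy : ∀ u, IsStrictlyProper (∑ l, y l * M.T l u) := fun u => by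
    rw [isStrictlyProper_iff, Finset.mul_sum]
    refine properRing.sum_mem fun l _ => ?_
    rw [← mul_assoc]
    exact properRing.mul_mem (stableRing_le_properRing (hstable l)) (hV.T_mem_properRing l u)
  have hA : (1 - M.G) * (1 - M.G)⁻¹ = 1 := Matrix.mul_nonsing_inv _ hV.det_ne_zero.isUnit
  set W := (1 - M.G)⁻¹ *
    (1 + (1 - ∑ k, y k * (1 - M.G)⁻¹ k j)⁻¹ • (E * (1 - M.G)⁻¹)) with hW
  have hmul : (1 - (M.addRow j y).G) * W = 1 := by
    have := sub_row_mul_eq_one hA j y (inv_mul_cancel₀ hne)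
    rwa [← hE, ← hW, sub_sub] at this
  have hWst : ∀ i l, W i l ∈ stableRing := by
    refine mul_apply_mem _ hV.inv_mem fun i l => ?_
    rw [Matrix.add_apply, Matrix.smul_apply, smul_eq_mul, Matrix.one_apply]
    refine stableRing.add_mem ?_ (stableRing.mul_mem hunit (mul_apply_mem _ hEst hV.inv_mem i l))
    split_ifs
    exacts [stableRing.one_mem, stableRing.zero_mem]
  have hdet : (1 - (M.addRow j y).G).det ≠ 0 :=
    (Matrix.isUnit_det_of_right_inverse hmul).ne_zero
  have hinv : (1 - (M.addRow j y).G)⁻¹ = W := Matrix.inv_eq_right_inv hmul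
  have hGst : ∀ i l, (M.addRow j y).G i l ∈ stableRing := fun i l =>
    stableRing.add_mem (hV.G_mem i l) (hEst i l)
  have hHst : ∀ i m, (M.addRow j y).H i m ∈ stableRing := fun i m => by
    refine stableRing.sub_mem (hV.H_mem i m) ?_
    split_ifs
    · exact stableRing.sum_mem fun l _ => stableRing.mul_mem (hyst l) (hV.T_mem_stableRing l m)
    · exact stableRing.zero_mem
  have hval : (M.addRow j y).G.map valueAtInfinity = M.G.map valueAtInfinity := by
    ext i l
    exact valueAtInfinity_add_of_isStrictlyProper (hV.G_proper i l) (hEsp i l)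
  refine ⟨⟨?_, ?_, ?_, hM.2.2.2⟩, addRow_T hV j y hdet⟩
  · exact
    { G_diag := fun i => by
        rw [addRow_G, hV.G_diag, zero_add]
        split_ifs with h
        · rw [h]; exact hy j (S.self_notMem j)
        · rfl
      G_proper := fun i l => (isProper_and_isStable_iff.2 (hGst i l)).1
      G_stable := fun i l => (isProper_and_isStable_iff.2 (hGst i l)).2
      R_proper := fun i k => by
        refine isProper_iff.2 (properRing.sub_mem (isProper_iff.1 (hV.R_proper i k)) ?_)
        split_ifs
        · exact isProper_iff.1 (hTy _).isProper
        · exact properRing.zero_mem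
      H_proper := fun i m => (isProper_and_isStable_iff.2 (hHst i m)).1
      H_stable := fun i m => (isProper_and_isStable_iff.2 (hHst i m)).2
      H_leftInverse := by
        obtain ⟨X, hX, hXH⟩ := hV.H_leftInverse
        refine ⟨X * ((1 - M.G) * W), fun m i => isProper_and_isStable_iff.2 ?_, ?_⟩
        · exact mul_apply_mem _ (fun m i => isProper_and_isStable_iff.1 (hX m i))
            (mul_apply_mem _ (one_sub_mem _ hV.G_mem) hWst) m i
        · have h1 : (M.addRow j y).H = (1 - (M.addRow j y).G) * M.T.submatrix id Sum.inr := by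
            ext i m
            exact (congrFun (congrFun (addRow_mul_T hV j y) i) (.inr m)).symm
          have h2 : M.H = (1 - M.G) * M.T.submatrix id Sum.inr := by
            ext i m
            exact (congrFun (congrFun hV.mul_T i) (.inr m)).symm
          have h3 : W * (1 - (M.addRow j y).G) = 1 := mul_eq_one_comm.1 hmul
          rw [h1, Matrix.mul_assoc, Matrix.mul_assoc, ← Matrix.mul_assoc W, h3, Matrix.one_mul,
            ← h2, hXH]
      H_monic := fun i m hi => by
        rw [← hV.H_monic i m hi]
        change valueAtInfinity (M.H i m - _) = _
        rw [sub_eq_add_neg]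
        refine valueAtInfinity_add_of_isStrictlyProper (hV.H_proper i m) ?_
        rw [isStrictlyProper_iff, mul_neg]
        refine properRing.neg_mem ?_
        split_ifs
        · exact isStrictlyProper_iff.1 (hTy _)
        · rw [mul_zero]; exact properRing.zero_mem
      Λ_posDef := hV.Λ_posDef
      det_ne_zero := hdet
      inv_proper := fun i l => by
        rw [hinv]; exact (isProper_and_isStable_iff.2 (hWst i l)).1
      inv_stable := fun i l => by
        rw [hinv]; exact (isProper_and_isStable_iff.2 (hWst i l)).2
      wellPosed_inv := by rw [hval]; exact hV.wellPosed_inv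
      wellPosed := by rw [hval]; exact hV.wellPosed }
  · intro i s hs
    rw [← hM.2.1 i s hs]
    by_cases hi : i = j
    · subst hi
      rcases s with l | u
      · change M.G i l + (if i = i then y l else 0) = M.G i l
        rw [if_pos rfl, hy l hs, add_zero]
      · change (M.addRow i y).U i u = M.U i u
        rw [addRow_U, if_pos rfl, hyT u (by simpa [UU] using hs), sub_zero]
    · rcases s with l | u
      · change M.G i l + (if i = j then y l else 0) = M.G i l
        rw [if_neg hi, add_zero]
      · change (M.addRow j y).U i u = M.U i u
        rw [addRow_U, if_neg hi, sub_zero]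
  · intro i l hl hf
    have h1 := isStrictlyProper_iff.1 (hM.2.2.1 i l hl hf)
    have h2 := isStrictlyProper_iff.1 (hEsp i l)
    rw [isStrictlyProper_iff]
    change RatFunc.X * (M.G i l + E i l) ∈ properRing
    rw [mul_add]
    exact properRing.add_mem h1 h2

/-- Every vector in the left kernel of the rows `𝒴_j` and columns `𝒰_j` of `T` is, up to a factor,
the difference between row `j` of `G` in the given model and in another model with the same `T`. -/
theorem exists_model_same_T {M : NetworkModel L K p} (hM : M ∈ S.models) {j : Fin L}
    {x : Fin L → RatFunc ℝ} (hx : ∀ l, l ∉ S.Y j → x l = 0)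
    (hxT : ∀ u ∈ S.UU j, ∑ l, x l * M.T l u = 0) :
    ∃ M₁ ∈ S.models, M₁.T = M.T ∧ ∃ c : RatFunc ℝ, c ≠ 0 ∧ ∀ l, M₁.G j l = M.G j l + c * x l := by
  obtain ⟨c, hc, hcx⟩ := exists_scaling x
  have hcx' : ∀ l, c * x l ∈ stableRing := fun l => by
    have := stableRing.mul_mem inv_X_mem_stableRing (hcx l)
    rwa [inv_mul_cancel_left₀ RatFunc.X_ne_zero] at this
  obtain ⟨t, ht, hne, hunit⟩ := exists_small_unit
    (stableRing.sum_mem fun k (_ : k ∈ Finset.univ) =>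
      stableRing.mul_mem (hcx' k) (hM.1.inv_mem k j))
  have hCt : RatFunc.C t ∈ stableRing := by
    rw [← invSubst_C]
    exact map_mem_fracSubring _ _ _
  have hsum : ∑ k, RatFunc.C t * c * x k * (1 - M.G)⁻¹ k j =
      RatFunc.C t * ∑ k, c * x k * (1 - M.G)⁻¹ k j := by
    rw [Finset.mul_sum]
    exact Finset.sum_congr rfl fun k _ => by ring
  obtain ⟨hmem, hT⟩ := addRow_mem_models hM (y := fun l => RatFunc.C t * c * x l)
    (fun l hl => by rw [hx l (by simpa [Y] using hl), mul_zero])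
    (fun u hu => by
      have : ∑ l, RatFunc.C t * c * x l * M.T l u = RatFunc.C t * c * ∑ l, x l * M.T l u := by
        rw [Finset.mul_sum]
        exact Finset.sum_congr rfl fun k _ => by ring
      rw [this, hxT u hu, mul_zero])
    (fun l => by
      have : RatFunc.X * (RatFunc.C t * c * x l) = RatFunc.C t * (RatFunc.X * (c * x l)) := by ring
      rw [this]
      exact stableRing.mul_mem hCt (hcx l))
    (by rwa [hsum]) (by rwa [hsum])
  refine ⟨_, hmem, hT, RatFunc.C t * c, mul_ne_zero ?_ hc, fun l => ?_⟩
  · rwa [map_ne_zero_iff _ RatFunc.C_injective]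
  · rw [NetworkModel.addRow_G, if_pos rfl]

end ModelSet

/-! ### Identifiability and rank -/

section

variable {F κ ι : Type*} [Field F] [Fintype κ]

theorem rank_of_rows (r : ι → κ → F) (Y : Finset ι) :
    (Matrix.of fun a : Y => r a).rank = Module.finrank F (Submodule.span F (r '' Y)) := by
  rw [Matrix.rank_eq_finrank_span_row, Set.image_eq_range]
  rfl

/-- Full row rank means that the left kernel is trivial. -/
theorem rank_eq_card_iff [Fintype ι] [DecidableEq ι] (r : ι → κ → F) (Y : Finset ι) :
    (Matrix.of fun a : Y => r a).rank = Y.card ↔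
      ∀ x : ι → F, (∀ l ∉ Y, x l = 0) → ∑ l, x l • r l = 0 → x = 0 := by
  have h1 : (Matrix.of fun a : Y => r a).rank = Y.card ↔ LinearIndepOn F r (Y : Set ι) := by
    rw [Matrix.rank_eq_finrank_span_row, ← Fintype.card_coe Y, eq_comm]
    exact linearIndependent_iff_card_eq_finrank_span.symm
  rw [h1, linearIndepOn_finset_iff]
  constructor
  · intro h x hx hsum
    have h2 : ∑ l ∈ Y, x l • r l = 0 := by
      rw [← hsum]
      exact Finset.sum_subset (Finset.subset_univ _) fun l _ hl => by rw [hx l hl, zero_smul]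
    funext l
    by_cases hl : l ∈ Y
    · exact h x h2 l hl
    · exact hx l hl
  · intro h g hg l hl
    have := h (fun l => if l ∈ Y then g l else 0) (fun l hl => if_neg hl) (by
      rw [← hg, ← Finset.sum_filter_add_sum_filter_not Finset.univ (· ∈ Y)]
      rw [Finset.sum_congr rfl (g := fun l => g l • r l)
        (fun l hl => by rw [if_pos (Finset.mem_filter.1 hl).2])]
      rw [Finset.sum_eq_zero (s := Finset.univ.filter fun l => l ∉ Y)
        (fun l hl => by rw [if_neg (Finset.mem_filter.1 hl).2, zero_smul])]
      rw [add_zero]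
      congr 1
      ext; simp)
    simpa [hl] using congrFun this l

/-- A row contributes to the rank if and only if its coefficient vanishes on the left kernel. -/
theorem rank_erase_lt_iff [Fintype ι] [DecidableEq ι] (r : ι → κ → F) {Y : Finset ι} {i : ι}
    (hi : i ∈ Y) :
    (Matrix.of fun a : (Y.erase i : Finset ι) => r a).rank < (Matrix.of fun a : Y => r a).rank ↔
      ∀ x : ι → F, (∀ l ∉ Y, x l = 0) → ∑ l, x l • r l = 0 → x i = 0 := by
  rw [rank_of_rows, rank_of_rows]
  set W := Submodule.span F (r '' (Y.erase i : Finset ι)) with hW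
  have hsup : Submodule.span F (r '' Y) = Submodule.span F {r i} ⊔ W := by
    conv_lhs => rw [← Finset.insert_erase hi]
    rw [Finset.coe_insert, Set.image_insert_eq, Submodule.span_insert]
  have h1 : Module.finrank F W < Module.finrank F (Submodule.span F (r '' Y)) ↔ r i ∉ W := by
    constructor
    · intro h hmem
      rw [hsup, sup_eq_right.2 ((Submodule.span_singleton_le_iff_mem _ _).2 hmem)] at h
      exact lt_irrefl _ h
    · intro h
      refine Submodule.finrank_lt_finrank_of_lt
        (lt_of_le_of_ne (hsup ▸ le_sup_right) fun h2 => h ?_)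
      rw [h2, hsup]
      exact Submodule.mem_sup_left (Submodule.mem_span_singleton_self _)
  rw [h1, hW, Submodule.mem_span_image_finset_iff_exists_fun']
  constructor
  · intro h x hx hsum
    by_contra hxi
    apply h
    refine ⟨fun l => -(x i)⁻¹ * x l, ?_⟩
    have h2 : x i • r i + ∑ l ∈ Y.erase i, x l • r l = 0 := by
      rw [Finset.add_sum_erase Y (fun l => x l • r l) hi, ← hsum]
      exact Finset.sum_subset (Finset.subset_univ _) fun l _ hl => by rw [hx l hl, zero_smul]
    simp_rw [mul_smul]
    rw [← Finset.smul_sum, eq_neg_of_add_eq_zero_right h2, neg_smul, smul_neg, neg_neg, smul_smul,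
      inv_mul_cancel₀ hxi, one_smul]
  · rintro h ⟨c, hc⟩
    have := h (fun l => if l = i then -1 else if l ∈ Y then c l else 0)
      (fun l hl => by rw [if_neg (by rintro rfl; exact hl hi), if_neg hl]) (by
        rw [← Finset.add_sum_erase _ _ (Finset.mem_univ i), if_pos rfl, neg_one_smul, ← hc,
          neg_add_eq_zero]
        refine Finset.sum_subset_zero_on_sdiff
          (Finset.erase_subset_erase i (Finset.subset_univ Y)) ?_ ?_
        · intro l hl
          simp only [Finset.mem_sdiff, Finset.mem_erase, Finset.mem_univ, and_true, ne_eq,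
            not_and] at hl
          rw [if_neg hl.1, if_neg (hl.2 hl.1), zero_smul]
        · intro l hl
          rw [Finset.mem_erase] at hl
          rw [if_neg hl.1, if_pos hl.2])
    simp at this

end

namespace ModelSet

variable {L K p : ℕ} {S : ModelSet L K p}

/-- The difference between rows `j` of `G` in two models with the same `T` is in the left kernel. -/
theorem sum_sub_mul_T {M M₁ : NetworkModel L K p} (hM : M ∈ S.models) (hM₁ : M₁ ∈ S.models)
    (hT : M₁.T = M.T) (j : Fin L) (u : Excitation K p) :
    ∑ l, (M₁.G j l - M.G j l) * M.T l u = M.U j u - M₁.U j u := by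
  have h1 := hM₁.1.mul_T
  rw [hT] at h1
  rw [← h1, ← hM.1.mul_T]
  simp only [Matrix.sub_apply, Matrix.mul_apply, sub_mul,
    Finset.sum_sub_distrib]
  ring

theorem rowDiff_mem_leftKernel {M M₁ : NetworkModel L K p} (hM : M ∈ S.models)
    (hM₁ : M₁ ∈ S.models) (hT : M₁.T = M.T) (j : Fin L) :
    (∀ l ∉ S.Y j, M₁.G j l - M.G j l = 0) ∧
      ∑ l, (M₁.G j l - M.G j l) • (fun u : S.UU j => M.T l u) = 0 := by
  constructor
  · intro l hl
    have hl' : Sum.inl l ∉ S.par j := by simpa [Y] using hl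
    exact sub_eq_zero.2 ((hM₁.2.1 j _ hl').trans (hM.2.1 j _ hl').symm)
  · ext1 u
    have hu : Sum.inr (u : Excitation K p) ∉ S.par j := by simpa [UU] using u.2
    rw [Finset.sum_apply]
    refine (sum_sub_mul_T hM hM₁ hT j u).trans ?_
    exact sub_eq_zero.2 ((hM.2.1 j _ hu).trans (hM₁.2.1 j _ hu).symm)

theorem rowIdentifiableAt_iff {M : NetworkModel L K p} (hM : M ∈ S.models) (j : Fin L) :
    S.RowIdentifiableAt j M ↔ (S.checkT j M).rank = S.α j := by
  rw [show S.checkT j M = Matrix.of fun a : S.Y j => fun u : S.UU j => M.T a u from rfl, α,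
    rank_eq_card_iff (fun l => fun u : S.UU j => M.T l u)]
  constructor
  · intro h x hx hsum
    obtain ⟨M₁, hM₁, hT, c, hc, hG⟩ := exists_model_same_T hM hx fun u hu => by
      have := congrFun hsum ⟨u, hu⟩
      rwa [Finset.sum_apply] at this
    funext l
    have h1 := congrFun (h M₁ hM₁ hT).1 l
    rw [hG, add_eq_left] at h1
    exact (mul_eq_zero.1 h1).resolve_left hc
  · intro h M₁ hM₁ hT
    obtain ⟨h1, h2⟩ := rowDiff_mem_leftKernel hM hM₁ hT j
    have h3 := h (fun l => M₁.G j l - M.G j l) h1 h2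
    have h4 : ∀ l, M₁.G j l - M.G j l = 0 := fun l => congrFun h3 l
    have h5 : ∀ u, M₁.U j u = M.U j u := fun u => by
      have := sum_sub_mul_T hM hM₁ hT j u
      simp only [h4, zero_mul, Finset.sum_const_zero] at this
      exact (sub_eq_zero.1 this.symm).symm
    exact ⟨funext fun l => sub_eq_zero.1 (h4 l), funext fun k => h5 (.inl k),
      funext fun m => h5 (.inr m)⟩

theorem moduleIdentifiableAt_iff {M : NetworkModel L K p} (hM : M ∈ S.models) {j i : Fin L}
    (hi : i ∈ S.Y j) :
    S.ModuleIdentifiableAt j i M ↔ (S.checkTErase j i M).rank < (S.checkT j M).rank := by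
  rw [show S.checkT j M = Matrix.of fun a : S.Y j => fun u : S.UU j => M.T a u from rfl,
    show S.checkTErase j i M = Matrix.of fun a : ((S.Y j).erase i : Finset (Fin L)) =>
      fun u : S.UU j => M.T a u from rfl,
    rank_erase_lt_iff (fun l => fun u : S.UU j => M.T l u) hi]
  constructor
  · intro h x hx hsum
    obtain ⟨M₁, hM₁, hT, c, hc, hG⟩ := exists_model_same_T hM hx fun u hu => by
      have := congrFun hsum ⟨u, hu⟩
      rwa [Finset.sum_apply] at this
    have h1 := h M₁ hM₁ hT
    rw [hG, add_eq_left] at h1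
    exact (mul_eq_zero.1 h1).resolve_left hc
  · intro h M₁ hM₁ hT
    obtain ⟨h1, h2⟩ := rowDiff_mem_leftKernel hM hM₁ hT j
    exact sub_eq_zero.1 (h (fun l => M₁.G j l - M.G j l) h1 h2)

theorem networkIdentifiableAt_iff {M : NetworkModel L K p} :
    S.NetworkIdentifiableAt M ↔ ∀ j, S.RowIdentifiableAt j M := by
  constructor
  · intro h j M₁ hM₁ hT
    obtain ⟨h1, h2, h3⟩ := h M₁ hM₁ hT
    exact ⟨congrFun h1 j, congrFun h2 j, congrFun h3 j⟩
  · intro h M₁ hM₁ hT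
    exact ⟨funext fun j => (h j M₁ hM₁ hT).1, funext fun j => (h j M₁ hM₁ hT).2.1,
      funext fun j => (h j M₁ hM₁ hT).2.2⟩

/-! ### Generic identifiability and paths -/

theorem forAlmostAll_congr {P Q : NetworkModel L K p → Prop}
    (h : ∀ M ∈ S.models, (P M ↔ Q M)) : S.ForAlmostAll P ↔ S.ForAlmostAll Q := by
  constructor <;> intro h' ν hν <;> filter_upwards [h' ν hν] with θ hθ hM
  exacts [(h _ hM).1 (hθ hM), (h _ hM).2 (hθ hM)]

theorem ForAlmostAll.and {P Q : NetworkModel L K p → Prop} (hP : S.ForAlmostAll P)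
    (hQ : S.ForAlmostAll Q) : S.ForAlmostAll fun M => P M ∧ Q M := by
  intro ν hν
  filter_upwards [hP ν hν, hQ ν hν] with θ h1 h2 hM
  exact ⟨h1 hM, h2 hM⟩

theorem forAlmostAll_forall {ι : Type*} [Countable ι] {P : ι → NetworkModel L K p → Prop} :
    S.ForAlmostAll (fun M => ∀ i, P i M) ↔ ∀ i, S.ForAlmostAll (P i) := by
  constructor
  · intro h i ν hν
    filter_upwards [h ν hν] with θ hθ hM
    exact hθ hM i
  · intro h ν hν
    filter_upwards [MeasureTheory.ae_all_iff.2 fun i => h i ν hν] with θ hθ hM i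
    exact hθ i hM

theorem HasDisjointPaths.le_card {U' : Finset (Excitation K p)} {Y' : Finset (Fin L)} {n : ℕ}
    (h : S.HasDisjointPaths U' Y' n) : n ≤ U'.card := by
  obtain ⟨P, hP, hd⟩ := h
  have h1 := Finset.card_le_card_of_injOn (s := Finset.univ) (t := U') (fun a => (P a).source)
    (fun a _ => (hP a).1) (fun a _ b _ hab => by
      by_contra hne
      exact (hd a b hne).1 hab)
  simpa using h1

theorem card_par_le {j : Fin L} (h : S.α j ≤ (S.UU j).card) : (S.par j).card ≤ K + p := by
  classical
  have h1 : S.Y j = (S.par j).toLeft := by ext; simp [Y]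
  have h2 : S.UU j = (S.par j).toRightᶜ := by ext; simp [UU]
  have h3 : (S.par j).toRight.card ≤ Fintype.card (Excitation K p) := Finset.card_le_univ _
  rw [h2, Finset.card_compl, α, h1] at h
  rw [← Finset.card_toLeft_add_card_toRight]
  simp only [Fintype.card_sum, Fintype.card_fin] at h h3
  omega

theorem forAlmostAll_rank_iff (hne : S.models.Nonempty) (hknown : S.KnownNondegenerate)
    (j : Fin L) : S.ForAlmostAll (fun M => (S.checkT j M).rank = S.α j) ↔
      S.HasDisjointPaths (S.UU j) (S.Y j) (S.α j) := by
  constructor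
  · intro h
    obtain ⟨M, hM, hrank⟩ := h.exists_model hne
    exact hrank ▸ hasDisjointPaths_rank hM j (S.Y j)
  · intro h ν hν
    filter_upwards [forAlmostAll_le_rank hne hknown j (S.Y j) h ν hν] with θ hθ hM
    refine le_antisymm ?_ (hθ hM)
    exact (Matrix.rank_le_card_height _).trans (by rw [Fintype.card_coe, α])

theorem exists_max_disjointPaths (S : ModelSet L K p) (U' : Finset (Excitation K p))
    (Y' : Finset (Fin L)) :
    ∃ n, S.HasDisjointPaths U' Y' n ∧ ∀ m, S.HasDisjointPaths U' Y' m → m ≤ n := by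
  classical
  have h0 : S.HasDisjointPaths U' Y' 0 := ⟨Fin.elim0, fun a => a.elim0, fun a => a.elim0⟩
  exact ⟨_, Nat.findGreatest_spec (P := fun n => S.HasDisjointPaths U' Y' n) (Nat.zero_le _) h0,
    fun m hm => Nat.le_findGreatest hm.le_card hm⟩

/-- An additional path to `i` exists if and only if the maximal number of disjoint paths grows when
`i` is admitted as a target. -/
theorem hasExtraPath_iff {U' : Finset (Excitation K p)} {Y' : Finset (Fin L)} {i : Fin L}
    (hi : i ∈ Y') : S.HasExtraPath U' (Y'.erase i) i ↔
      ∃ n, (∀ m, S.HasDisjointPaths U' (Y'.erase i) m → m ≤ n) ∧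
        S.HasDisjointPaths U' Y' (n + 1) := by
  constructor
  · rintro ⟨n, P, hP, hmax, Q, hQU, hQi, hQ⟩
    refine ⟨n, hmax, Fin.cons Q P, fun a => ?_, fun a b hab => ?_⟩
    · refine Fin.cases ?_ (fun a => ?_) a
      · exact ⟨hQU, by simpa [hQi] using hi⟩
      · exact ⟨(hP.1 a).1, Finset.mem_of_mem_erase (hP.1 a).2⟩
    · induction a using Fin.cases with
      | zero =>
        induction b using Fin.cases with
        | zero => exact absurd rfl hab
        | succ b => exact hQ b
      | succ a =>
        induction b using Fin.cases with
        | zero => exact ⟨fun h => (hQ a).1 h.symm, fun x hx hx' => (hQ a).2 x hx' hx⟩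
        | succ b => exact hP.2 a b fun h => hab (h ▸ rfl)
  · rintro ⟨n, hmax, P, hP, hd⟩
    -- Some path ends in `i`, since otherwise there are too many paths to the other targets.
    have h1 : ∃ a, (P a).target = i := by
      by_contra h
      push Not at h
      have := hmax (n + 1) ⟨P, fun a => ⟨(hP a).1, Finset.mem_erase.2 ⟨h a, (hP a).2⟩⟩, hd⟩
      omega
    obtain ⟨a, ha⟩ := h1
    refine ⟨n, fun b => P (a.succAbove b), ⟨fun b => ⟨(hP _).1, Finset.mem_erase.2 ⟨?_, (hP _).2⟩⟩,
      fun b c hbc => hd _ _ fun h => hbc (Fin.succAbove_right_injective h)⟩, hmax, P a, (hP a).1,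
      ha, fun b => hd _ _ (Fin.succAbove_ne a b).symm⟩
    intro hb
    exact (hd _ _ (Fin.succAbove_ne a b)).2 i (hb ▸ Path.target_mem _) (ha ▸ Path.target_mem _)

theorem forAlmostAll_rank_lt_iff (hne : S.models.Nonempty) (hknown : S.KnownNondegenerate)
    {j i : Fin L} (hi : i ∈ S.Y j) :
    S.ForAlmostAll (fun M => (S.checkTErase j i M).rank < (S.checkT j M).rank) ↔
      S.HasExtraPath (S.UU j) ((S.Y j).erase i) i := by
  rw [hasExtraPath_iff hi]
  constructor
  · intro h
    obtain ⟨n, hn, hmax⟩ := S.exists_max_disjointPaths (S.UU j) ((S.Y j).erase i)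
    obtain ⟨M, hM, hlt, hle⟩ := (h.and (forAlmostAll_le_rank hne hknown j _ hn)).exists_model hne
    exact ⟨n, hmax, (hasDisjointPaths_rank hM j (S.Y j)).mono (lt_of_le_of_lt hle hlt)⟩
  · rintro ⟨n, hmax, hn⟩ ν hν
    filter_upwards [forAlmostAll_le_rank hne hknown j (S.Y j) hn ν hν] with θ hθ hM
    exact lt_of_le_of_lt (hmax _ (hasDisjointPaths_rank hM j _)) (hθ hM)

end ModelSet

end DynNet

theorem mainTheorem2 {L K p : ℕ} (hp : p ≤ L) (S : DynNet.ModelSet L K p)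
    (hne : S.models.Nonempty) (hknown : S.KnownNondegenerate) :
    -- the full network
    ((S.ForAlmostAll S.NetworkIdentifiableAt ↔
        ∀ j, S.HasDisjointPaths (S.UU j) (S.Y j) (S.α j)) ∧
      (((∀ j, (S.par j).card ≤ K + p) ∧
          S.ForAlmostAll (fun M => ∀ j, (S.checkT j M).rank = S.α j)) ↔
        ∀ j, S.HasDisjointPaths (S.UU j) (S.Y j) (S.α j))) ∧
    -- one row
    (∀ j,
      (S.ForAlmostAll (S.RowIdentifiableAt j) ↔
        S.HasDisjointPaths (S.UU j) (S.Y j) (S.α j)) ∧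
      (((S.par j).card ≤ K + p ∧ S.ForAlmostAll (fun M => (S.checkT j M).rank = S.α j)) ↔
        S.HasDisjointPaths (S.UU j) (S.Y j) (S.α j))) ∧
    -- one parametrized module
    (∀ j, ∀ i ∈ S.Y j,
      (S.ForAlmostAll (S.ModuleIdentifiableAt j i) ↔
        S.HasExtraPath (S.UU j) ((S.Y j).erase i) i) ∧
      (S.ForAlmostAll (fun M => (S.checkTErase j i M).rank < (S.checkT j M).rank) ↔
        S.HasExtraPath (S.UU j) ((S.Y j).erase i) i)) := by
  have hrow : ∀ j, S.ForAlmostAll (S.RowIdentifiableAt j) ↔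
      S.HasDisjointPaths (S.UU j) (S.Y j) (S.α j) := fun j =>
    (DynNet.ModelSet.forAlmostAll_congr fun _ hM =>
      DynNet.ModelSet.rowIdentifiableAt_iff hM j).trans
      (DynNet.ModelSet.forAlmostAll_rank_iff hne hknown j)
  have hrank := DynNet.ModelSet.forAlmostAll_rank_iff hne hknown
  have hcard : ∀ j, S.HasDisjointPaths (S.UU j) (S.Y j) (S.α j) → (S.par j).card ≤ K + p :=
    fun j h => DynNet.ModelSet.card_par_le h.le_card
  refine ⟨⟨?_, ?_⟩, fun j => ⟨hrow j, ?_⟩, fun j i hi => ⟨?_, ?_⟩⟩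
  · rw [DynNet.ModelSet.forAlmostAll_congr fun _ _ => DynNet.ModelSet.networkIdentifiableAt_iff,
      DynNet.ModelSet.forAlmostAll_forall]
    exact forall_congr' hrow
  · rw [DynNet.ModelSet.forAlmostAll_forall]
    exact ⟨fun h j => (hrank j).1 (h.2 j), fun h => ⟨fun j => hcard j (h j),
      fun j => (hrank j).2 (h j)⟩⟩
  · exact ⟨fun h => (hrank j).1 h.2, fun h => ⟨hcard j h, (hrank j).2 h⟩⟩
  · exact (DynNet.ModelSet.forAlmostAll_congr fun _ hM =>
      DynNet.ModelSet.moduleIdentifiableAt_iff hM hi).trans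
      (DynNet.ModelSet.forAlmostAll_rank_lt_iff hne hknown hi)
  · exact DynNet.ModelSet.forAlmostAll_rank_lt_iff hne hknown hi
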